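/- **Setting in one dimension.** Let $m\ge 0$ and $n\ge 2m+1$ be integers and $I=[0,1]$. Let $\ell_k$ be the Legendre polynomial of degree $k$ on $I$ with $\ell_k(1)=1$, let $L^0_k=\ell_k$ and $L^{\alpha+1}_k(x)=\int_0^x L^\alpha_k(t)\,dt$, and for $\alpha\in\{0,1\}$, $0\le\beta\le m$ let $h_{\alpha,\beta}$ be the polynomial of degree at most $2m+1$ whose derivatives of orders $0,\dots,m$ vanish at $0$ and $1$, except that $h_{\alpha,\beta}^{(\beta)}(\alpha)=1$. Identify $0$-forms $u$ and $1$-forms $v\,dx$ on $I$ with functions $u$, $v$. Node functionals for $0$-forms are $$\mathcal N^0_{2i+1}(u)=u^{(i+1)}(0),\quad \mathcal N^0_{2i+2}(u)=u^{(i+1)}(1)\quad(0\le i<m),$$ $$\mathcal N^0_{2m+i}(u)=\int_0^1\ell_{i-1}u'\,dx\quad(1\le i\le n-2m),\qquad \mathcal N^0_{n+1}(u)=u(1)+u(0),$$ with basis functions $\phi^0_{2j+1}=h_{0,j+1}$, $\phi^0_{2j+2}=h_{1,j+1}$ $(0\le j<m)$, $\phi^0_{2m+1}=\frac12(h_{1,0}-h_{0,0})$,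 $\phi^0_{2m+j}=L^{m+1}_{j+m-1}$ $(2\le j\le n-2m)$, $\phi^0_{n+1}=\frac12(h_{0,0}+h_{1,0})$. For $1$-forms, $$\mathcal N^1_{2i+1}(v)=v^{(i)}(0),\quad \mathcal N^1_{2i+2}(v)=v^{(i)}(1)\quad(0\le i<m),\qquad \mathcal N^1_{2m+i}(v)=\int_0^1\ell_{i-1}v\,dx\quad(1\le i\le n-2m),$$ with basis functions $\phi^1_j=(\phi^0_j)'$, $1\le j\le n$. For $k=0,1$ let $M_k=(\mathcal N^k_i(\phi^k_j))_{ij}$ and let $I_ku=\sum_j c_j\phi^k_j$ with $c=M_k^{-1}(\mathcal N^k_i(u))_i$ be the interpolation operator. **Setting in $N$ dimensions.** Let $\chi_\nu=\{\mathbf i\in\{0,1\}^N:\sum_\ell i_\ell=\nu\}$ and, for $\mathbf i\in\chi_\nu$, let $dx^{\mathbf i}$ be the wedge product, in increasing order, of the $dx_\ell$ with $i_\ell=1$. Smooth forms on the closed cube $I^N$ are written $u=\sum_{\mathbf i\in\chi_\nu}u_{\mathbf i}\,dx^{\mathbf i}\in C^\infty\Lambda^\nu(I^N)$. The tensor product interpolation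 operator is $$I^{\otimes N}_\nu u=\sum_{\mathbf i\in\chi_\nu}\bigl((I_{i_1}\otimes\cdots\otimes I_{i_N})u_{\mathbf i}\bigr)\,dx^{\mathbf i},$$ where the $\ell$-th factor acts on the $\ell$-th variable. The tensor product space $V^\nu=(\mathbb P\Lambda^{\otimes N})^\nu$ is the span of the forms $p_1(x_1)\cdots p_N(x_N)\,dx^{\mathbf i}$ with $\mathbf i\in\chi_\nu$ and polynomials $p_\ell$ of degree at most $n-i_\ell$. **Lemma 2.** For all $N,\nu\ge 0$, $m\ge0$ and $n\ge 2m+1$: 1. $I^{\otimes N}_\nu$ is a cochain map: $I^{\otimes N}_{\nu+1}\,du=d\,I^{\otimes N}_\nu u$ on $I^N$ for all $u\in C^\infty\Lambda^\nu(I^N)$. 2. The spaces $V^\nu$ form a subcomplex of the de Rham complex: $V^\nu\subset C^\infty\Lambda^\nu(I^N)$ and $dV^\nu\subset V^{\nu+1}$. 3. $I^{\otimes N}_\nu$ is a projection onto $V^\nu$: $I^{\otimes N}_\nu u\in V^\nu$ for every $u\in C^\infty\Lambda^\nu(I^N)$, and $I^{\otimes N}_\nu w=w$ on $I^N$ for every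 $w\in V^\nu$. 4. The elements are $C^m$-conforming: let $u,v\in C^\infty\Lambda^\nu(I^N)$, $1\le\ell\le N$ and $a,b\in\{0,1\}$, and suppose that for all $\mathbf i\in\chi_\nu$ and all $\gamma\ge0$ with $\gamma+i_\ell\le m$ the trace of $\partial_\ell^\gamma u_{\mathbf i}$ on the face $x_\ell=a$ equals the trace of $\partial_\ell^\gamma v_{\mathbf i}$ on the face $x_\ell=b$ (as functions of the other variables). Then the same holds for $I^{\otimes N}_\nu u$ and $I^{\otimes N}_\nu v$ in place of $u$ and $v$. -/

import Mathlib

open scoped ContDiff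

noncomputable section

namespace TPFE

open Polynomial

/-! ### Polynomials on the reference interval `[0, 1]` -/

/-- Legendre polynomial `ℓ_k` of degree `k` on `[0, 1]`, normalized by `ℓ_k(1) = 1`
(the shifted Legendre polynomial of Mathlib takes the value `(-1)^k` at `1`). -/
def legendre (k : ℕ) : ℝ[X] :=
  C ((-1 : ℝ) ^ k) * (Polynomial.shiftedLegendre k).map (Int.castRingHom ℝ)

/-- The antiderivative `x ↦ ∫₀ˣ p(t) dt` of a polynomial. -/
def antideriv (p : ℝ[X]) : ℝ[X] :=
  p.sum fun k a => monomial (k + 1) (a / ((k : ℝ) + 1))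

/-- `L^α_j`, the `α`-fold integral from `0` of the Legendre polynomial `ℓ_j`. -/
def integratedLegendre (α j : ℕ) : ℝ[X] :=
  antideriv^[α] (legendre j)

/-- `h_{0,β}` for `β ≤ m`: the polynomial of degree at most `2m+1` whose derivatives of order
`0, …, m` vanish at `0` and at `1`, except that the `β`-th derivative at `0` equals `1`
(see `hermiteLeft_at_zero`, `hermiteLeft_at_one`). -/
def hermiteLeft (m β : ℕ) : ℝ[X] :=
  C ((β.factorial : ℝ)⁻¹) * X ^ β *
    ((1 - X) ^ (m + 1) * ∑ k ∈ Finset.range (m - β + 1), C ((m + k).choose m : ℝ) * X ^ k)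

/-- `h_{1,β}` for `β ≤ m`: the polynomial of degree at most `2m+1` whose derivatives of order
`0, …, m` vanish at `0` and at `1`, except that the `β`-th derivative at `1` equals `1`
(see `hermiteRight_at_zero`, `hermiteRight_at_one`). -/
def hermiteRight (m β : ℕ) : ℝ[X] :=
  C ((-1 : ℝ) ^ β) * (hermiteLeft m β).comp (1 - X)

theorem hermite_coeff_aux (m r d : ℕ) (hd : d ≤ r) :
    ((1 - X : ℝ[X]) ^ (m + 1) *
      ∑ k ∈ Finset.range (r + 1), C ((m + k).choose m : ℝ) * X ^ k).coeff d
      = if d = 0 then 1 else 0 := by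
  have h := PowerSeries.mk_add_choose_mul_one_sub_pow_eq_one ℝ m
  have h2 := congrArg (PowerSeries.coeff d) h
  rw [PowerSeries.coeff_one, mul_comm, PowerSeries.coeff_mul] at h2
  rw [← h2, Polynomial.coeff_mul]
  refine Finset.sum_congr rfl fun p hp => ?_
  have hp' := Finset.HasAntidiagonal.mem_antidiagonal.1 hp
  congr 1
  · rw [← Polynomial.coeff_coe]; simp
  · simp [Polynomial.finsetSum_coeff, Polynomial.coeff_X_pow]
    omega

theorem hermiteLeft_at_zero (m β γ : ℕ) (hβ : β ≤ m) (hγ : γ ≤ m) :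
    (derivative^[γ] (hermiteLeft m β)).eval 0 = if β = γ then 1 else 0 := by
  rw [← coeff_zero_eq_eval_zero, coeff_iterate_derivative, zero_add, Nat.descFactorial_self,
    hermiteLeft, mul_assoc, coeff_C_mul, coeff_X_pow_mul']
  split_ifs with h1 h2 h2
  · subst h2
    rw [Nat.sub_self, hermite_coeff_aux _ _ _ (Nat.zero_le _)]
    simp [Nat.factorial_ne_zero]
  · rw [hermite_coeff_aux _ _ _ (by omega), if_neg (by omega)]
    simp
  · omega
  · simp

theorem hermiteLeft_at_one (m β γ : ℕ) (hγ : γ ≤ m) :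
    (derivative^[γ] (hermiteLeft m β)).eval 1 = 0 := by
  have h : (1 - X : ℝ[X]) ^ (m + 1) ∣ hermiteLeft m β :=
    Dvd.dvd.mul_left (Dvd.intro _ rfl) _
  have h1 : (1 - X : ℝ[X]) ∣ derivative^[γ] (hermiteLeft m β) :=
    (dvd_pow_self _ (by omega)).trans (pow_sub_dvd_iterate_derivative_of_pow_dvd γ h)
  obtain ⟨q, hq⟩ := h1
  simp [hq]

theorem hermiteRight_at_one (m β γ : ℕ) (hβ : β ≤ m) (hγ : γ ≤ m) :
    (derivative^[γ] (hermiteRight m β)).eval 1 = if β = γ then 1 else 0 := by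
  rw [hermiteRight, iterate_derivative_C_mul, iterate_derivative_comp_one_sub_X]
  simp only [eval_mul, eval_C, eval_pow, eval_neg, eval_one, eval_comp, eval_sub, eval_X, sub_self,
    hermiteLeft_at_zero m β γ hβ hγ]
  split_ifs with h
  · subst h
    rw [mul_one, ← mul_pow]; simp
  · simp

theorem hermiteRight_at_zero (m β γ : ℕ) (hγ : γ ≤ m) :
    (derivative^[γ] (hermiteRight m β)).eval 0 = 0 := by
  rw [hermiteRight, iterate_derivative_C_mul, iterate_derivative_comp_one_sub_X]
  simp [hermiteLeft_at_one m β γ hγ]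

/-! ### The finite elements in one dimension

Forms on `[0, 1]` are represented by their proxies: a `0`-form by a function `u`, a `1`-form
`v dx` by the function `v`. Node functionals and basis functions are numbered from `0`. -/

/-- The `j`-th node functional for `0`-forms, `0 ≤ j ≤ n`: derivatives of order `1, …, m` at the
two end points, then the moments of `u'` against `ℓ_0, …, ℓ_{n-2m-1}`, then `u(1) + u(0)`. -/
def node0 (m n : ℕ) (j : Fin (n + 1)) (u : ℝ → ℝ) : ℝ :=
  if (j : ℕ) < 2 * m then
    iteratedDerivWithin ((j : ℕ) / 2 + 1) u (Set.Icc 0 1) (if (j : ℕ) % 2 = 0 then 0 else 1)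
  else if (j : ℕ) < n then
    ∫ x in (0 : ℝ)..1, (legendre ((j : ℕ) - 2 * m)).eval x * derivWithin u (Set.Icc 0 1) x
  else u 1 + u 0

/-- The `j`-th basis function for `0`-forms, `0 ≤ j ≤ n`. -/
def basis0 (m n : ℕ) (j : Fin (n + 1)) : ℝ[X] :=
  if (j : ℕ) < 2 * m then
    if (j : ℕ) % 2 = 0 then hermiteLeft m ((j : ℕ) / 2 + 1) else hermiteRight m ((j : ℕ) / 2 + 1)
  else if (j : ℕ) = n then C (1 / 2) * (hermiteLeft m 0 + hermiteRight m 0)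
  else if (j : ℕ) = 2 * m then C (1 / 2) * (hermiteRight m 0 - hermiteLeft m 0)
  else integratedLegendre (m + 1) ((j : ℕ) - m)

/-- The `j`-th node functional for `1`-forms, `0 ≤ j < n`: derivatives of order `0, …, m-1` at the
two end points, then the moments of `v` against `ℓ_0, …, ℓ_{n-2m-1}`. -/
def node1 (m n : ℕ) (j : Fin n) (v : ℝ → ℝ) : ℝ :=
  if (j : ℕ) < 2 * m then
    iteratedDerivWithin ((j : ℕ) / 2) v (Set.Icc 0 1) (if (j : ℕ) % 2 = 0 then 0 else 1)
  else ∫ x in (0 : ℝ)..1, (legendre ((j : ℕ) - 2 * m)).eval x * v x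

/-- The `j`-th basis function for `1`-forms, `0 ≤ j < n`. -/
def basis1 (m n : ℕ) (j : Fin n) : ℝ[X] :=
  derivative (basis0 m n j.castSucc)

/-- The matrix of node functionals applied to basis functions. -/
def nodalMatrix {ι : Type} (node : ι → (ℝ → ℝ) → ℝ) (φ : ι → ℝ[X]) : Matrix ι ι ℝ :=
  Matrix.of fun i j => node i fun x => (φ j).eval x

/-- Finite element interpolation: the element `∑ⱼ cⱼ φⱼ` of the span of the basis functions whose
coefficients solve `∑ⱼ 𝒩ᵢ(φⱼ) cⱼ = 𝒩ᵢ(u)` for all `i`. -/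
def interpolate {ι : Type} [Fintype ι] [DecidableEq ι] (node : ι → (ℝ → ℝ) → ℝ) (φ : ι → ℝ[X])
    (u : ℝ → ℝ) (x : ℝ) : ℝ :=
  ∑ i, node i u * ∑ j, (nodalMatrix node φ)⁻¹ j i * (φ j).eval x

/-- The one-dimensional interpolation operators `I_0` and `I_1`. -/
def interp (m n : ℕ) (k : Fin 2) : (ℝ → ℝ) → ℝ → ℝ :=
  if k = 0 then interpolate (node0 m n) (basis0 m n) else interpolate (node1 m n) (basis1 m n)

/-! ### Differential forms on the cube -/

/-- The cube `[0, 1]^N`. -/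
def cube (N : ℕ) : Set (Fin N → ℝ) := Set.Icc 0 1

/-- Differential `ν`-forms in `N` variables; on the cube, only the values there matter. -/
abbrev Form (N ν : ℕ) : Type := (Fin N → ℝ) → (Fin N → ℝ) [⋀^Fin ν]→L[ℝ] ℝ

/-- Smooth `ν`-forms on the (closed) cube. -/
def IsSmooth {N ν : ℕ} (u : Form N ν) : Prop := ContDiffOn ℝ ∞ u (cube N)

/-- The exterior derivative of a form on the cube. -/
def dForm {N ν : ℕ} (u : Form N ν) : Form N (ν + 1) := extDerivWithin u (cube N)

/-- The index set `χ_ν` of the vectors `i ∈ {0,1}^N` with `∑ i_ℓ = ν`. -/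
abbrev Chi (N ν : ℕ) : Type := {i : Fin N → Fin 2 // ∑ l, (i l : ℕ) = ν}

/-- The set of the `ℓ` with `i_ℓ = 1`. -/
def Chi.support {N ν : ℕ} (i : Chi N ν) : Finset (Fin N) := Finset.univ.filter fun l => i.1 l = 1

theorem Chi.card_support {N ν : ℕ} (i : Chi N ν) : i.support.card = ν := by
  rw [Chi.support, Finset.card_filter]
  refine (Finset.sum_congr rfl fun l _ => ?_).trans i.2
  generalize i.1 l = k
  fin_cases k <;> simp

/-- The increasing enumeration of the `ℓ` with `i_ℓ = 1`. -/
def Chi.dirs {N ν : ℕ} (i : Chi N ν) : Fin ν ↪o Fin N := i.support.orderEmbOfFin i.card_support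

/-- The basic form `dx^i = dx_{ℓ_1} ∧ ⋯ ∧ dx_{ℓ_ν}`, where `ℓ_1 < ⋯ < ℓ_ν` are the `ℓ` with
`i_ℓ = 1`: its value on `v_1, …, v_ν` is `det (dx_{ℓ_b} v_a)`. -/
def Chi.dx {N ν : ℕ} (i : Chi N ν) : (Fin N → ℝ) [⋀^Fin ν]→L[ℝ] ℝ where
  toMultilinearMap := ((Matrix.detRowAlternating (n := Fin ν) (R := ℝ)).compLinearMap
    (LinearMap.funLeft ℝ ℝ i.dirs)).toMultilinearMap
  map_eq_zero_of_eq' := ((Matrix.detRowAlternating (n := Fin ν) (R := ℝ)).compLinearMap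
    (LinearMap.funLeft ℝ ℝ i.dirs)).map_eq_zero_of_eq'
  cont := by
    change Continuous fun v : Fin ν → Fin N → ℝ => Matrix.det (fun a b => v a (i.dirs b))
    refine Continuous.matrix_det ?_
    fun_prop

/-- The coefficient `u_i` of `u = ∑_i u_i dx^i`. -/
def Form.coeff {N ν : ℕ} (u : Form N ν) (i : Chi N ν) (x : Fin N → ℝ) : ℝ :=
  u x fun b => Pi.single (i.dirs b) 1

/-! ### Tensor products -/

/-- The tensor product `A_1 ⊗ ⋯ ⊗ A_N` of operators on functions of one variable: `A_ℓ` acts on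
the `ℓ`-th variable, the other variables being fixed. -/
def tensorOp : {N : ℕ} → (Fin N → (ℝ → ℝ) → ℝ → ℝ) → ((Fin N → ℝ) → ℝ) → (Fin N → ℝ) → ℝ
  | 0, _, f, x => f x
  | _ + 1, A, f, x =>
      A 0 (fun t => tensorOp (fun l => A l.succ) (fun y => f (Fin.cons t y)) (Fin.tail x)) (x 0)

/-- The tensor product interpolation operator `∑_{i ∈ χ_ν} I_{i_1} ⊗ ⋯ ⊗ I_{i_N}` on `ν`-forms; the
summand with index `i` acts on the component `u_i dx^i` and annihilates the others. -/
def tensorInterp (m n : ℕ) {N ν : ℕ} (u : Form N ν) : Form N ν := fun x =>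
  ∑ i : Chi N ν, tensorOp (fun l => interp m n (i.1 l)) (u.coeff i) x • i.dx

/-- The rank-one form `(⨂_ℓ p_ℓ) dx^i`. -/
def rankOne {N ν : ℕ} (i : Chi N ν) (p : Fin N → ℝ[X]) : Form N ν := fun x =>
  (∏ l, (p l).eval (x l)) • i.dx

/-- The tensor product space `⨁_{i ∈ χ_ν} P_{n-i_1}Λ^{i_1} ⊗ ⋯ ⊗ P_{n-i_N}Λ^{i_N}`. -/
def tensorSpace (n N ν : ℕ) : Submodule ℝ (Form N ν) :=
  Submodule.span ℝ
    {w | ∃ (i : Chi N ν) (p : Fin N → ℝ[X]),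
      (∀ l, p l ∈ degreeLE ℝ ((n - (i.1 l : ℕ) : ℕ) : WithBot ℕ)) ∧ w = rankOne i p}

/-- The `γ`-th partial derivative in the `l`-th variable of a function on the cube. -/
def partialDeriv {N : ℕ} (l : Fin N) (γ : ℕ) (f : (Fin N → ℝ) → ℝ) (x : Fin N → ℝ) : ℝ :=
  iteratedDerivWithin γ (fun t => f (Function.update x l t)) (Set.Icc 0 1) (x l)

/-- The traces of `u` on the face `x_l = a` and of `v` on the face `x_l = b` agree to the order
required by `C^m` forms: for each `i`, the normal derivatives of order `0, …, m - i_l` of the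
coefficients `u_i` and `v_i`. -/
def SameTraces (m : ℕ) {N ν : ℕ} (l : Fin N) (a b : ℝ) (u v : Form N ν) : Prop :=
  ∀ (i : Chi N ν) (γ : ℕ), γ + (i.1 l : ℕ) ≤ m → ∀ x ∈ cube N,
    partialDeriv l γ (u.coeff i) (Function.update x l a) =
      partialDeriv l γ (v.coeff i) (Function.update x l b)

end TPFE

end

open scoped ContDiff

noncomputable section

namespace TPFE

open Polynomial MeasureTheory Set

/-! ### Node functionals as integrals -/

/-! Every node functional has the form `u ↦ ∫ w · u^(r) dμ` with a polynomial weight, an order `r`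
and a finite measure carried by `[0, 1]`. The `1`-form functional of the same index has order `r -
1`, so it takes on `u'` the value of the `0`-form functional on `u` (`nodePoly_derivative`); only
the last `0`-form functional has no partner.

The functionals are unisolvent. A polynomial of degree below `n` killed by all `1`-form functionals
is `x^m (1-x)^m q`, and its moments force `∫ x^m (1-x)^m q² = 0` (`unisolvent_one`); `0`-forms
reduce to this by differentiation (`unisolvent_zero`). As the bases are linearly independent, the
nodal matrices are invertible, and interpolation is `∑ N_j(u) s_j` with dual polynomials `s_j`
(`shape`). Duality gives `derivative_shape`: differentiation maps `0`-form shape functions to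
`1`-form ones, and the last to zero.

In several variables Fubini turns the iterated operator into `∑_J N_J(u) ∏ s_{J_l}(x_l)`
(`IsJet.tensorOp_interp_eq`). Only the partial derivatives of `u` enter; they are recorded as jets,
which pass to faces and survive the application of functionals in some of the variables. Termwise
differentiation shows that interpolation commutes with each `∂_l`, hence with `d`. Products of
polynomials are reproduced one variable at a time, so interpolation is a projection, and `dw = d(Iw)
= I(dw)` yields the subcomplex.

For conformity, end point derivatives of order at most `m - k` are combinations of node functionals
and so are reproduced. The normal derivative of the interpolant on a face is thus the interpolant,
in the other variables, of the normal derivative of the form; it depends only on the trace, since a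
jet is determined by its first member (`IsJet.eqOn`). -/

theorem integrable_of_continuousOn_of_ae_mem {α : Type*} [TopologicalSpace α] [T2Space α]
    [MeasurableSpace α] [OpensMeasurableSpace α] [SecondCountableTopology α]
    {μ : Measure α} [IsFiniteMeasure μ] {s : Set α}
    (hs : IsCompact s) (hμ : ∀ᵐ x ∂μ, x ∈ s) {g : α → ℝ} (hg : ContinuousOn g s) :
    Integrable g μ := by
  have h := hg.integrableOn_compact' (μ := μ) hs hs.measurableSet
  rwa [IntegrableOn, Measure.restrict_eq_self_of_ae_mem hμ] at h

/-- The order of the derivative of a `0`-form that enters the `j`-th node functional. -/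
def nodeOrder (m n j : ℕ) : ℕ :=
  if j < 2 * m then j / 2 + 1 else if j < n then 1 else 0

/-- The polynomial weight of the `j`-th node functional. -/
def nodeWeight (m n j : ℕ) : ℝ[X] :=
  if j < 2 * m then 1 else if j < n then legendre (j - 2 * m) else 1

/-- The measure against which the `j`-th node functional integrates. -/
def nodeMeasure (m n j : ℕ) : Measure ℝ :=
  if j < 2 * m then Measure.dirac (if j % 2 = 0 then 0 else 1)
  else if j < n then volume.restrict (Icc 0 1)
  else Measure.dirac 0 + Measure.dirac 1

instance isFiniteMeasure_nodeMeasure (m n j : ℕ) : IsFiniteMeasure (nodeMeasure m n j) := by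
  unfold nodeMeasure
  split_ifs <;> infer_instance

theorem ae_nodeMeasure_mem (m n j : ℕ) : ∀ᵐ t ∂nodeMeasure m n j, t ∈ Icc (0 : ℝ) 1 := by
  unfold nodeMeasure
  split_ifs
  · simp [ae_dirac_eq]
  · simp [ae_dirac_eq]
  · exact ae_restrict_mem measurableSet_Icc
  · rw [ae_add_measure_iff]
    simp [ae_dirac_eq]

/-- A sequence of functions on `[0, 1]` each of which is the derivative of the preceding one. -/
def IsJetInterval (u : ℕ → ℝ → ℝ) : Prop :=
  ∀ k, ∀ t ∈ Icc (0 : ℝ) 1, HasDerivWithinAt (u k) (u (k + 1) t) (Icc 0 1) t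

theorem IsJetInterval.continuousOn {u : ℕ → ℝ → ℝ} (hu : IsJetInterval u) (k : ℕ) :
    ContinuousOn (u k) (Icc 0 1) :=
  fun t ht => (hu k t ht).continuousWithinAt

theorem IsJetInterval.iteratedDerivWithin_eq {u : ℕ → ℝ → ℝ} (hu : IsJetInterval u) (k : ℕ) :
    EqOn (iteratedDerivWithin k (u 0) (Icc 0 1)) (u k) (Icc 0 1) := by
  induction k with
  | zero => intro t _; simp
  | succ k ih =>
    intro t ht
    rw [iteratedDerivWithin_succ, derivWithin_congr ih (ih ht)]
    exact (hu k t ht).derivWithin (uniqueDiffOn_Icc zero_lt_one t ht)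

/-- The `j`-th node functional for `k`-forms on a jet. -/
def nodeFun (m n k j : ℕ) (u : ℕ → ℝ → ℝ) : ℝ :=
  ∫ t, (nodeWeight m n j).eval t * u (nodeOrder m n j - k) t ∂nodeMeasure m n j

theorem IsJetInterval.node0_eq {u : ℕ → ℝ → ℝ} (hu : IsJetInterval u) (m n : ℕ)
    (j : Fin (n + 1)) : node0 m n j (u 0) = nodeFun m n 0 j u := by
  unfold node0 nodeFun nodeOrder nodeWeight nodeMeasure
  split_ifs with h1 h2 h3
  · simp [hu.iteratedDerivWithin_eq _ (show (0 : ℝ) ∈ Icc (0 : ℝ) 1 by simp)]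
  · simp [hu.iteratedDerivWithin_eq _ (show (1 : ℝ) ∈ Icc (0 : ℝ) 1 by simp)]
  · rw [intervalIntegral.integral_of_le zero_le_one, ← integral_Icc_eq_integral_Ioc]
    refine setIntegral_congr_fun measurableSet_Icc fun t ht => ?_
    rw [(hu 0 t ht).derivWithin (uniqueDiffOn_Icc zero_lt_one t ht)]
  · rw [integral_add_measure (integrable_dirac (by simp)) (integrable_dirac (by simp))]
    simp [add_comm]

theorem IsJetInterval.node1_eq {u : ℕ → ℝ → ℝ} (hu : IsJetInterval u) (m n : ℕ) (j : Fin n) :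
    node1 m n j (u 0) = nodeFun m n 1 j u := by
  unfold node1 nodeFun nodeOrder nodeWeight nodeMeasure
  split_ifs with h1 h2 h3
  · simp [hu.iteratedDerivWithin_eq _ (show (0 : ℝ) ∈ Icc (0 : ℝ) 1 by simp)]
  · simp [hu.iteratedDerivWithin_eq _ (show (1 : ℝ) ∈ Icc (0 : ℝ) 1 by simp)]
  · rw [intervalIntegral.integral_of_le zero_le_one, ← integral_Icc_eq_integral_Ioc]
  -- The sum of end point values has index `n`, which `1`-forms do not have.
  · exact absurd j.2 h3

/-- The successive derivatives of a polynomial function. -/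
def polyJet (p : ℝ[X]) (k : ℕ) (t : ℝ) : ℝ := (derivative^[k] p).eval t

theorem isJetInterval_polyJet (p : ℝ[X]) : IsJetInterval (polyJet p) := fun k t _ => by
  have := (derivative^[k] p).hasDerivAt t
  rw [← Function.iterate_succ_apply' (f := derivative)] at this
  exact this.hasDerivWithinAt

theorem IsJetInterval.integrable {u : ℕ → ℝ → ℝ} (hu : IsJetInterval u) (m n j k : ℕ) :
    Integrable (fun t => (nodeWeight m n j).eval t * u k t) (nodeMeasure m n j) :=
  integrable_of_continuousOn_of_ae_mem isCompact_Icc (ae_nodeMeasure_mem m n j)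
    ((Polynomial.continuous _).continuousOn.mul (hu.continuousOn k))

/-- The `j`-th node functional for `k`-forms on polynomials. -/
def nodePoly (m n k j : ℕ) : ℝ[X] →ₗ[ℝ] ℝ where
  toFun p := nodeFun m n k j (polyJet p)
  map_add' p q := by
    unfold nodeFun
    rw [← integral_add ((isJetInterval_polyJet p).integrable ..)
      ((isJetInterval_polyJet q).integrable ..)]
    simp [polyJet, mul_add]
  map_smul' c p := by
    unfold nodeFun
    rw [RingHom.id_apply, smul_eq_mul, ← integral_const_mul]
    refine integral_congr_ae (.of_forall fun t => ?_)
    simp only [polyJet, iterate_derivative_smul, eval_smul, smul_eq_mul]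
    ring

theorem node0_eval (m n : ℕ) (j : Fin (n + 1)) (p : ℝ[X]) :
    node0 m n j (fun x => p.eval x) = nodePoly m n 0 j p :=
  (isJetInterval_polyJet p).node0_eq m n j

theorem node1_eval (m n : ℕ) (j : Fin n) (p : ℝ[X]) :
    node1 m n j (fun x => p.eval x) = nodePoly m n 1 j p :=
  (isJetInterval_polyJet p).node1_eq m n j

theorem nodeOrder_pos {m n j : ℕ} (hj : j < n) : 1 ≤ nodeOrder m n j := by
  unfold nodeOrder; split_ifs <;> omega

/-- The orders differ by one and are at least `1` below index `n`, so the truncated subtraction is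
exact. -/
theorem nodePoly_derivative {m n j : ℕ} (hj : j < n) (p : ℝ[X]) :
    nodePoly m n 1 j (derivative p) = nodePoly m n 0 j p := by
  have h := nodeOrder_pos (m := m) hj
  change nodeFun m n 1 j _ = nodeFun m n 0 j _
  unfold nodeFun polyJet
  rw [← Function.iterate_succ_apply, Nat.succ_eq_add_one, Nat.sub_add_cancel h, Nat.sub_zero]

theorem nodeFun_left {m n i : ℕ} (hi : i < m) (k : ℕ) (u : ℕ → ℝ → ℝ) :
    nodeFun m n k (2 * i) u = u (i + 1 - k) 0 := by
  simp [nodeFun, nodeWeight, nodeOrder, nodeMeasure, hi]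

theorem nodeFun_right {m n i : ℕ} (hi : i < m) (k : ℕ) (u : ℕ → ℝ → ℝ) :
    nodeFun m n k (2 * i + 1) u = u (i + 1 - k) 1 := by
  have h : 2 * i + 1 < 2 * m := by omega
  have h2 : (2 * i + 1) / 2 = i := by omega
  simp [nodeFun, nodeWeight, nodeOrder, nodeMeasure, h, h2]

theorem nodeFun_zero_last {m n : ℕ} (hn : 2 * m + 1 ≤ n) (u : ℕ → ℝ → ℝ) :
    nodeFun m n 0 n u = u 0 0 + u 0 1 := by
  have h : ¬ n < 2 * m := by omega
  simp only [nodeFun, nodeWeight, nodeOrder, nodeMeasure, h, lt_irrefl, if_false]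
  rw [integral_add_measure (integrable_dirac (by simp)) (integrable_dirac (by simp))]
  simp

/-- Since `ℓ_0 = 1`, this is the fundamental theorem of calculus. Together with `nodeFun_zero_last`
it recovers both end point values. -/
theorem IsJetInterval.nodeFun_zero_mean {u : ℕ → ℝ → ℝ} (hu : IsJetInterval u) {m n : ℕ}
    (hn : 2 * m + 1 ≤ n) : nodeFun m n 0 (2 * m) u = u 0 1 - u 0 0 := by
  have h : 2 * m < n := by omega
  have hl : legendre 0 = 1 := by simp [legendre, shiftedLegendre]
  simp only [nodeFun, nodeWeight, nodeOrder, nodeMeasure, h, lt_irrefl, if_false, if_true,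
    Nat.sub_self, Nat.sub_zero, hl, eval_one, one_mul]
  rw [integral_Icc_eq_integral_Ioc, ← intervalIntegral.integral_of_le zero_le_one]
  refine intervalIntegral.integral_eq_sub_of_hasDerivAt_of_le zero_le_one (hu.continuousOn 0)
    (fun t ht => (hu 0 t (Ioo_subset_Icc_self ht)).hasDerivAt (Icc_mem_nhds ht.1 ht.2)) ?_
  exact (hu.continuousOn 1).intervalIntegrable_of_Icc zero_le_one

theorem nodePoly_one_moment {m n i : ℕ} (hi : 2 * m + i < n) (p : ℝ[X]) :
    nodePoly m n 1 (2 * m + i) p = ∫ t in Icc (0 : ℝ) 1, (legendre i).eval t * p.eval t := by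
  change nodeFun m n 1 _ _ = _
  simp [nodeFun, nodeWeight, nodeOrder, nodeMeasure, hi, polyJet]

/-! ### Unisolvence -/

theorem degree_legendre (k : ℕ) : (legendre k).degree = k := by
  rw [legendre, degree_C_mul (by simp), degree_map_eq_of_injective Int.cast_injective,
    degree_shiftedLegendre]

/-- The Legendre polynomials, one in each degree. -/
def legendreSequence : Polynomial.Sequence ℝ := ⟨legendre, degree_legendre⟩

theorem span_legendre (k : ℕ) : Submodule.span ℝ (legendre '' Iio k) = degreeLT ℝ k :=
  legendreSequence.span_degreeLT fun i _ => by
    simp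

theorem pow_dvd_of_derivatives_vanish {p : ℝ[X]} {t : ℝ} {k : ℕ}
    (h : ∀ i < k, (derivative^[i] p).eval t = 0) : (X - C t) ^ k ∣ p := by
  rcases eq_or_ne p 0 with rfl | hp
  · exact dvd_zero _
  rcases Nat.eq_zero_or_pos k with rfl | hk
  · simp
  rw [← le_rootMultiplicity_iff hp]
  have := (lt_rootMultiplicity_iff_isRoot_iterate_derivative (n := k - 1) hp (t := t)).2
    fun i hi => h i (by omega)
  omega

theorem exists_eq_mul_of_derivatives_vanish {p : ℝ[X]} {k : ℕ}
    (h0 : ∀ i < k, (derivative^[i] p).eval 0 = 0) (h1 : ∀ i < k, (derivative^[i] p).eval 1 = 0) :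
    ∃ q, p = X ^ k * (1 - X) ^ k * q := by
  have h0' := pow_dvd_of_derivatives_vanish h0
  have h1' := pow_dvd_of_derivatives_vanish h1
  have hc : IsCoprime (X - C (0 : ℝ)) (X - C 1) := isCoprime_X_sub_C_of_isUnit_sub (by simp)
  obtain ⟨q, hq⟩ := (hc.pow (m := k) (n := k)).mul_dvd h0' h1'
  -- The sign converts `(X - 1)^k` into `(1 - X)^k`, which is positive inside the interval.
  refine ⟨(-1) ^ k * q, ?_⟩
  have : (X - C 1 : ℝ[X]) = (1 - X) * (-1) := by simp
  rw [hq, this, mul_pow]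
  simp only [map_zero, sub_zero]
  ring

theorem degree_eq_of_bubble (k : ℕ) (q : ℝ[X]) :
    (X ^ k * (1 - X) ^ k * q : ℝ[X]).degree = (2 * k : ℕ) + q.degree := by
  have : (1 - X : ℝ[X]).degree = 1 := by
    rw [← neg_sub, degree_neg]; simpa using degree_X_sub_C (1 : ℝ)
  rw [degree_mul, degree_mul, degree_pow, degree_pow, this, degree_X]
  simp [two_mul]

/-- A polynomial of degree at most `2m + 1` is determined by its derivatives of order at most `m`
at the end points. -/
theorem hermite_unique {m : ℕ} {p : ℝ[X]} (hp : p.degree < (2 * m + 2 : ℕ))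
    (h0 : ∀ i ≤ m, (derivative^[i] p).eval 0 = 0) (h1 : ∀ i ≤ m, (derivative^[i] p).eval 1 = 0) :
    p = 0 := by
  obtain ⟨q, rfl⟩ := exists_eq_mul_of_derivatives_vanish (k := m + 1)
    (fun i hi => h0 i (by omega)) (fun i hi => h1 i (by omega))
  rw [degree_eq_of_bubble] at hp
  rcases eq_or_ne q 0 with rfl | hq
  · simp
  rw [degree_eq_natDegree hq] at hp
  norm_cast at hp
  omega

/-- The integrand is `q²` times a weight positive on `(0, 1)`, and a nonzero polynomial cannot
vanish on all of `(0, 1)`. -/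
theorem eq_zero_of_integral_bubble {k : ℕ} {q : ℝ[X]}
    (h : ∫ t in Icc (0 : ℝ) 1, q.eval t * (X ^ k * (1 - X) ^ k * q).eval t = 0) : q = 0 := by
  have hc : Continuous fun t : ℝ => q.eval t * (X ^ k * (1 - X) ^ k * q).eval t := by fun_prop
  rw [integral_Icc_eq_integral_Ioc, ← intervalIntegral.integral_of_le zero_le_one] at h
  by_contra hq
  obtain ⟨t, ht, htq⟩ : ∃ t ∈ Ioo (0 : ℝ) 1, q.eval t ≠ 0 := by
    by_contra! hcon
    exact hq (eq_zero_of_infinite_isRoot q ((Ioo_infinite zero_lt_one).mono hcon))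
  have hpos : ∀ s ∈ Icc (0 : ℝ) 1, 0 ≤ q.eval s * (X ^ k * (1 - X) ^ k * q).eval s := by
    intro s hs
    have h1 := hs.1
    have h2 : 0 ≤ 1 - s := by linarith [hs.2]
    have : q.eval s * (X ^ k * (1 - X) ^ k * q).eval s
        = s ^ k * (1 - s) ^ k * (q.eval s * q.eval s) := by simp; ring
    rw [this]
    exact mul_nonneg (by positivity) (mul_self_nonneg _)
  have h3 := intervalIntegral.integral_pos zero_lt_one hc.continuousOn
    (fun s hs => hpos s (Ioc_subset_Icc_self hs)) ⟨t, Ioo_subset_Icc_self ht, by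
      have h1 := ht.1
      have h2 : 0 < 1 - t := by linarith [ht.2]
      have : q.eval t * (X ^ k * (1 - X) ^ k * q).eval t
          = t ^ k * (1 - t) ^ k * (q.eval t * q.eval t) := by simp; ring
      rw [this]
      have := mul_self_pos.2 htq
      positivity⟩
  linarith

/-- The end point functionals extract the factor `x^m (1-x)^m`. The cofactor has degree below `n -
2m`, so it lies in the span of the Legendre weights and may itself be used as a test function. -/
theorem unisolvent_one {m n : ℕ} (hn : 2 * m + 1 ≤ n) {p : ℝ[X]} (hp : p.degree < n)
    (h : ∀ j < n, nodePoly m n 1 j p = 0) : p = 0 := by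
  obtain ⟨q, rfl⟩ := exists_eq_mul_of_derivatives_vanish (p := p) (k := m)
    (fun i hi => (nodeFun_left (n := n) hi 1 (polyJet p)).symm.trans (h _ (by omega)))
    (fun i hi => (nodeFun_right (n := n) hi 1 (polyJet p)).symm.trans (h _ (by omega)))
  have hq : q ∈ degreeLT ℝ (n - 2 * m) := by
    rw [mem_degreeLT]
    rw [degree_eq_of_bubble] at hp
    rcases eq_or_ne q 0 with rfl | hq
    · simp
    rw [degree_eq_natDegree hq] at hp ⊢
    norm_cast at hp ⊢
    omega
  rw [← span_legendre] at hq
  set p := X ^ m * (1 - X) ^ m * q with hpdef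
  have key : ∀ r ∈ Submodule.span ℝ (legendre '' Iio (n - 2 * m)),
      ∫ t in Icc (0 : ℝ) 1, r.eval t * p.eval t = 0 := by
    have hint : ∀ r : ℝ[X], IntegrableOn (fun t => r.eval t * p.eval t) (Icc (0 : ℝ) 1) :=
      fun r => Continuous.integrableOn_Icc (by fun_prop)
    intro r hr
    induction hr using Submodule.span_induction with
    | mem r hr =>
      obtain ⟨i, hi, rfl⟩ := hr
      simp only [mem_Iio] at hi
      have hi' : 2 * m + i < n := by omega
      rw [← nodePoly_one_moment hi']
      exact h _ hi'
    | zero => simp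
    | add r s _ _ hr hs =>
      simp only [eval_add, add_mul]
      rw [integral_add (hint r) (hint s), hr, hs, add_zero]
    | smul c r _ hr =>
      simp only [eval_smul, smul_eq_mul, mul_assoc]
      rw [integral_const_mul, hr, mul_zero]
  rw [hpdef, eq_zero_of_integral_bubble (key q hq), mul_zero]

/-- By `unisolvent_one` the derivative vanishes, and the last functional kills the remaining
constant. -/
theorem unisolvent_zero {m n : ℕ} (hn : 2 * m + 1 ≤ n) {p : ℝ[X]} (hp : p.degree < (n + 1 : ℕ))
    (h : ∀ j ≤ n, nodePoly m n 0 j p = 0) : p = 0 := by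
  have hd : derivative p = 0 := by
    refine unisolvent_one hn ?_ fun j hj => by
      rw [nodePoly_derivative hj]; exact h j hj.le
    rcases eq_or_ne p 0 with rfl | hp0
    · simp
    rcases Nat.eq_zero_or_pos p.natDegree with h0 | h0
    · rw [derivative_of_natDegree_zero h0, degree_zero]; exact WithBot.bot_lt_coe _
    rw [degree_eq_natDegree hp0] at hp
    norm_cast at hp
    refine degree_le_natDegree.trans_lt ?_
    have := natDegree_derivative_lt h0.ne'
    norm_cast
    omega
  have hc := eq_C_of_derivative_eq_zero hd
  have hl : p.eval 0 + p.eval 1 = 0 := (nodeFun_zero_last hn (polyJet p)).symm.trans (h n le_rfl)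
  rw [hc] at hl
  simp only [eval_C] at hl
  rw [hc, show p.coeff 0 = 0 by linarith, C_0]

/-! ### The basis functions -/

theorem coeff_antideriv_succ (p : ℝ[X]) (k : ℕ) :
    (antideriv p).coeff (k + 1) = p.coeff k / ((k : ℝ) + 1) := by
  rw [antideriv, Polynomial.sum, finsetSum_coeff]
  simp only [coeff_monomial, Nat.add_right_cancel_iff]
  rw [Finset.sum_ite_eq' p.support k]
  split_ifs with h
  · rfl
  · rw [notMem_support_iff.1 h, zero_div]

theorem natDegree_antideriv {p : ℝ[X]} (hp : p ≠ 0) :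
    (antideriv p).natDegree = p.natDegree + 1 := by
  refine natDegree_eq_of_le_of_coeff_ne_zero (natDegree_le_iff_coeff_eq_zero.2 fun k hk => ?_) ?_
  · obtain ⟨k, rfl⟩ := Nat.exists_eq_add_of_lt (Nat.zero_lt_of_lt hk)
    rw [zero_add] at hk ⊢
    rw [coeff_antideriv_succ, coeff_eq_zero_of_natDegree_lt (by omega), zero_div]
  · rw [coeff_antideriv_succ]
    exact div_ne_zero (by simpa using hp) (by positivity)

theorem antideriv_ne_zero {p : ℝ[X]} (hp : p ≠ 0) : antideriv p ≠ 0 := fun h => by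
  have := natDegree_antideriv hp
  rw [h, natDegree_zero] at this
  omega

theorem integratedLegendre_ne_zero_and_natDegree (α j : ℕ) :
    integratedLegendre α j ≠ 0 ∧ (integratedLegendre α j).natDegree = j + α := by
  induction α with
  | zero =>
    exact ⟨legendreSequence.ne_zero j, legendreSequence.natDegree_eq j⟩
  | succ α ih =>
    rw [integratedLegendre, Function.iterate_succ_apply', ← integratedLegendre]
    exact ⟨antideriv_ne_zero ih.1, by rw [natDegree_antideriv ih.1, ih.2]; ring⟩

theorem natDegree_hermiteLeft_le {m β : ℕ} (hβ : β ≤ m) :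
    (hermiteLeft m β).natDegree ≤ 2 * m + 1 := by
  have h1 : (∑ k ∈ Finset.range (m - β + 1), C ((m + k).choose m : ℝ) * X ^ k).natDegree
      ≤ m - β := by
    refine natDegree_sum_le_of_forall_le _ _ fun k hk => ?_
    have := Finset.mem_range.1 hk
    exact (natDegree_C_mul_X_pow_le _ _).trans (by omega)
  have h2 : ((1 - X : ℝ[X]) ^ (m + 1)).natDegree ≤ m + 1 := by
    have : (1 - X : ℝ[X]).natDegree ≤ 1 := (natDegree_sub_le _ _).trans (by simp)
    simpa using natDegree_pow_le_of_le (m + 1) this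
  have h3 : (C ((β.factorial : ℝ)⁻¹) * X ^ β).natDegree ≤ β := natDegree_C_mul_X_pow_le _ _
  exact (natDegree_mul_le_of_le h3 (natDegree_mul_le_of_le h2 h1)).trans (by omega)

theorem natDegree_hermiteRight_le {m β : ℕ} (hβ : β ≤ m) :
    (hermiteRight m β).natDegree ≤ 2 * m + 1 := by
  refine (natDegree_C_mul_le _ _).trans (natDegree_comp_le.trans ?_)
  have : (1 - X : ℝ[X]).natDegree ≤ 1 := (natDegree_sub_le _ _).trans (by simp)
  calc _ ≤ (2 * m + 1) * 1 := Nat.mul_le_mul (natDegree_hermiteLeft_le hβ) this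
    _ = _ := mul_one _

/-- Both sides have the same Hermite data at the two end points. It makes the last `0`-form basis
function constant, hence invisible to `d`. -/
theorem hermiteLeft_add_hermiteRight (m : ℕ) : hermiteLeft m 0 + hermiteRight m 0 = 1 := by
  rw [← sub_eq_zero]
  refine hermite_unique (m := m) ?_ ?_ ?_
  · refine degree_le_natDegree.trans_lt (Nat.cast_lt.2 (Nat.lt_succ_of_le ?_))
    refine (natDegree_sub_le _ _).trans (max_le ((natDegree_add_le _ _).trans (max_le ?_ ?_)) ?_)
    · exact natDegree_hermiteLeft_le m.zero_le
    · exact natDegree_hermiteRight_le m.zero_le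
    · simp
  · intro i hi
    rw [iterate_derivative_sub, iterate_map_add, eval_sub, eval_add,
      hermiteLeft_at_zero m 0 i m.zero_le hi, hermiteRight_at_zero m 0 i hi]
    rcases i with _ | i
    · simp
    · simp [Function.iterate_succ_apply]
  · intro i hi
    rw [iterate_derivative_sub, iterate_map_add, eval_sub, eval_add,
      hermiteLeft_at_one m 0 i hi, hermiteRight_at_one m 0 i m.zero_le hi]
    rcases i with _ | i
    · simp
    · simp [Function.iterate_succ_apply]

theorem basis0_last {m n : ℕ} (hn : 2 * m + 1 ≤ n) : basis0 m n (Fin.last n) = C (1 / 2) := by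
  simp only [basis0, Fin.val_last, hermiteLeft_add_hermiteRight, mul_one]
  rw [if_neg (by omega), if_pos trivial]

theorem natDegree_basis0_hermite {m n : ℕ} {j : Fin (n + 1)} (hj : (j : ℕ) ≤ 2 * m ∨ (j : ℕ) = n) :
    (basis0 m n j).natDegree ≤ 2 * m + 1 := by
  have h0 := natDegree_hermiteLeft_le m.zero_le
  have h1 := natDegree_hermiteRight_le m.zero_le
  unfold basis0
  split_ifs with h h' h' h'
  · exact natDegree_hermiteLeft_le (by omega)
  · exact natDegree_hermiteRight_le (by omega)
  · exact (natDegree_C_mul_le _ _).trans ((natDegree_add_le _ _).trans (max_le h0 h1))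
  · exact (natDegree_C_mul_le _ _).trans ((natDegree_sub_le _ _).trans (max_le h1 h0))
  · omega

theorem basis0_eq_integratedLegendre {m n : ℕ} {j : Fin (n + 1)} (hj : 2 * m < (j : ℕ))
    (hjn : (j : ℕ) < n) : basis0 m n j = integratedLegendre (m + 1) (j - m) := by
  rw [basis0, if_neg (by omega), if_neg (by omega), if_neg (by omega)]

theorem natDegree_basis0_legendre {m n : ℕ} {j : Fin (n + 1)} (hj : 2 * m < (j : ℕ))
    (hjn : (j : ℕ) < n) : (basis0 m n j).natDegree = j + 1 := by
  rw [basis0_eq_integratedLegendre hj hjn, (integratedLegendre_ne_zero_and_natDegree _ _).2]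
  omega

theorem natDegree_basis0_le {m n : ℕ} (hn : 2 * m + 1 ≤ n) (j : Fin (n + 1)) :
    (basis0 m n j).natDegree ≤ n := by
  by_cases hj : (j : ℕ) ≤ 2 * m ∨ (j : ℕ) = n
  · exact (natDegree_basis0_hermite hj).trans hn
  · have := j.2
    rw [natDegree_basis0_legendre (by omega) (by omega)]
    omega

theorem natDegree_basis1_le {m n : ℕ} (hn : 2 * m + 1 ≤ n) (j : Fin n) :
    (basis1 m n j).natDegree ≤ n - 1 :=
  (natDegree_derivative_le _).trans (Nat.sub_le_sub_right (natDegree_basis0_le hn _) 1)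

/-- Triangularity in the degree: the integrated Legendre function of index `j` has degree exactly `j
+ 1 ≥ 2m + 2`, the Hermite functions have degree at most `2m + 1`. The induction descends from the
top degree. -/
theorem coeff_eq_zero_of_sum_basis0_eq_zero {m n : ℕ} {c : Fin (n + 1) → ℝ}
    (hc : ∑ j, c j • basis0 m n j = 0) (j : Fin (n + 1)) (hj : 2 * m < (j : ℕ))
    (hjn : (j : ℕ) < n) : c j = 0 := by
  induction hd : n - (j : ℕ) using Nat.strong_induction_on generalizing j with
  | _ d ih =>
    have h := congrArg (fun p => coeff p (j + 1)) hc
    simp only [finsetSum_coeff, coeff_smul, coeff_zero, smul_eq_mul] at h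
    rw [Finset.sum_eq_single j] at h
    · refine (mul_eq_zero.1 h).resolve_right ?_
      rw [← natDegree_basis0_legendre hj hjn, coeff_natDegree, leadingCoeff_eq_zero,
        basis0_eq_integratedLegendre hj hjn]
      exact (integratedLegendre_ne_zero_and_natDegree _ _).1
    · intro i _ hij
      have hij' : (i : ℕ) ≠ j := fun h => hij (Fin.ext h)
      by_cases hi : (i : ℕ) ≤ 2 * m ∨ (i : ℕ) = n
      · rw [coeff_eq_zero_of_natDegree_lt ((natDegree_basis0_hermite hi).trans_lt (by omega)),
          mul_zero]
      · have := i.2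
        rcases lt_or_ge (i : ℕ) j with h | h
        · rw [coeff_eq_zero_of_natDegree_lt
            (by rw [natDegree_basis0_legendre (by omega) (by omega)]; omega), mul_zero]
        · rw [ih (n - i) (by omega) i (by omega) (by omega) rfl, zero_mul]
    · simp

/-- The degree removes the integrated Legendre functions, derivatives at the end points remove the
Hermite functions of positive order, and the values at `0` and `1` separate the two functions left.
-/
theorem linearIndependent_basis0 {m n : ℕ} (hn : 2 * m + 1 ≤ n) :
    LinearIndependent ℝ (basis0 m n) := by
  rw [Fintype.linearIndependent_iff]
  intro c hc
  have hbig := coeff_eq_zero_of_sum_basis0_eq_zero hc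
  have hval (γ : ℕ) (t : ℝ) : ∑ j, c j * (derivative^[γ] (basis0 m n j)).eval t = 0 := by
    have h := congrArg (fun p => (derivative^[γ] p).eval t) hc
    simpa [iterate_derivative_sum, eval_finsetSum, iterate_derivative_smul] using h
  have hsmall (j : Fin (n + 1)) (hj : (j : ℕ) < 2 * m) : c j = 0 := by
    -- The order and the end point of the node functional of index `j`.
    have h := hval ((j : ℕ) / 2 + 1) (if (j : ℕ) % 2 = 0 then 0 else 1)
    have hγ : (j : ℕ) / 2 + 1 ≤ m := by omega
    rw [Finset.sum_eq_single j] at h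
    · rw [basis0, if_pos hj] at h
      split_ifs at h with h2
      · rwa [hermiteLeft_at_zero _ _ _ hγ hγ, if_pos rfl, mul_one] at h
      · rwa [hermiteRight_at_one _ _ _ hγ hγ, if_pos rfl, mul_one] at h
    · intro i _ hij
      have hij' : (i : ℕ) ≠ j := fun h => hij (Fin.ext h)
      have hi := i.2
      rcases lt_or_ge (2 * m) (i : ℕ) with h1 | h1
      · rcases Nat.lt_or_eq_of_le (Nat.lt_succ_iff.1 hi) with h2 | h2
        · rw [hbig i h1 h2, zero_mul]
        · rw [show i = Fin.last n from Fin.ext h2, basis0_last hn]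
          simp [Function.iterate_succ_apply]
      · have hm : (i : ℕ) ≠ n := by omega
        rcases h1.eq_or_lt with h1 | h1
        · have h1' : ¬ (i : ℕ) < 2 * m := by omega
          rw [basis0, if_neg h1', if_neg hm, if_pos h1, iterate_derivative_C_mul,
            iterate_derivative_sub]
          split_ifs
          · rw [eval_mul, eval_sub, hermiteLeft_at_zero m 0 _ m.zero_le hγ,
              hermiteRight_at_zero m 0 _ hγ]
            simp
          · rw [eval_mul, eval_sub, hermiteRight_at_one m 0 _ m.zero_le hγ,
              hermiteLeft_at_one m 0 _ hγ]
            simp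
        · rw [basis0, if_pos h1]
          have hi' : (i : ℕ) / 2 + 1 ≤ m := by omega
          split_ifs with a1 a2 a2
          · rw [hermiteLeft_at_zero _ _ _ hi' hγ, if_neg (by omega), mul_zero]
          · rw [hermiteRight_at_zero _ _ _ hγ, mul_zero]
          · rw [hermiteLeft_at_one _ _ _ hγ, mul_zero]
          · rw [hermiteRight_at_one _ _ _ hi' hγ, if_neg (by omega), mul_zero]
    · simp
  have hrest (t : ℝ) : c ⟨2 * m, by omega⟩ * (basis0 m n ⟨2 * m, by omega⟩).eval t
      + c (Fin.last n) * (1 / 2) = 0 := by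
    have h := hval 0 t
    rw [Fin.sum_univ_castSucc, Finset.sum_eq_single ⟨2 * m, by omega⟩, basis0_last hn] at h
    · simpa using h
    · intro i _ hi
      have hi' : (i : ℕ) ≠ 2 * m := fun h => hi (Fin.ext h)
      rcases lt_or_ge (2 * m) (i : ℕ) with h1 | h1
      · rw [hbig i.castSucc h1 i.2, zero_mul]
      · rw [hsmall i.castSucc (lt_of_le_of_ne h1 hi'), zero_mul]
    · simp
  have hb (t : ℝ) : (basis0 m n ⟨2 * m, by omega⟩).eval t
      = 1 / 2 * ((hermiteRight m 0).eval t - (hermiteLeft m 0).eval t) := by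
    rw [basis0, if_neg (by simp), if_neg (by simp; omega), if_pos (by simp)]
    simp
  have e0 := hrest 0
  have e1 := hrest 1
  have l0 : (hermiteLeft m 0).eval 0 = 1 := hermiteLeft_at_zero m 0 0 m.zero_le m.zero_le
  have l1 : (hermiteLeft m 0).eval 1 = 0 := hermiteLeft_at_one m 0 0 m.zero_le
  have r0 : (hermiteRight m 0).eval 0 = 0 := hermiteRight_at_zero m 0 0 m.zero_le
  have r1 : (hermiteRight m 0).eval 1 = 1 := hermiteRight_at_one m 0 0 m.zero_le m.zero_le
  rw [hb, l0, r0] at e0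
  rw [hb, l1, r1] at e1
  intro j
  rcases lt_or_ge (j : ℕ) (2 * m) with h1 | h1
  · exact hsmall j h1
  rcases h1.eq_or_lt with h1 | h1
  · rw [show j = ⟨2 * m, by omega⟩ from Fin.ext h1.symm]; linarith
  rcases Nat.lt_or_eq_of_le (Nat.lt_succ_iff.1 j.2) with h2 | h2
  · exact hbig j h1 h2
  · rw [show j = Fin.last n from Fin.ext h2]; linarith

theorem linearIndependent_basis1 {m n : ℕ} (hn : 2 * m + 1 ≤ n) :
    LinearIndependent ℝ (basis1 m n) := by
  have h0 := linearIndependent_basis0 hn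
  rw [Fintype.linearIndependent_iff] at h0 ⊢
  intro c hc
  have hd : derivative (∑ j, c j • basis0 m n (Fin.castSucc j)) = 0 := by
    rw [← hc, derivative_sum]
    exact Finset.sum_congr rfl fun j _ => derivative_smul _ _
  have hC := eq_C_of_derivative_eq_zero hd
  set κ := (∑ j, c j • basis0 m n (Fin.castSucc j)).coeff 0
  -- The combination of antiderivatives is the constant `κ`; the last basis function is `1/2`, so
  -- the coefficient `-2κ` turns this into a relation among the `0`-form basis functions.
  have := h0 (Fin.snoc c (-2 * κ)) (by
    rw [Fin.sum_univ_castSucc]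
    simp only [Fin.snoc_castSucc, Fin.snoc_last]
    rw [hC, basis0_last hn, smul_C, ← C_add, smul_eq_mul,
      show κ + -2 * κ * (1 / 2) = 0 by ring, C_0])
  intro j
  simpa using this j.castSucc

/-! ### Shape functions -/

/-- A kernel vector gives a combination killed by all functionals; unisolvence makes the combination
zero, independence the vector. -/
theorem isUnit_of_unisolvent {ι : Type} [Fintype ι] [DecidableEq ι] {F : ι → ℝ[X] →ₗ[ℝ] ℝ}
    {φ : ι → ℝ[X]} (hφ : LinearIndependent ℝ φ)
    (h : ∀ c : ι → ℝ, (∀ i, F i (∑ j, c j • φ j) = 0) → ∑ j, c j • φ j = 0) :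
    IsUnit (Matrix.of fun i j => F i (φ j)) := by
  rw [← Matrix.mulVec_injective_iff_isUnit, ← Matrix.coe_mulVecLin, injective_iff_map_eq_zero]
  intro c hc
  rw [Fintype.linearIndependent_iff] at hφ
  refine funext (hφ c (h c fun i => ?_))
  have := congrFun hc i
  simpa [Matrix.mulVec, dotProduct, mul_comm] using this

/-- The combination of the basis functions dual to the `j`-th node functional. -/
def dualPoly {ι : Type} [Fintype ι] [DecidableEq ι] (node : ι → (ℝ → ℝ) → ℝ) (φ : ι → ℝ[X])
    (j : ι) : ℝ[X] := ∑ i, (nodalMatrix node φ)⁻¹ i j • φ i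

theorem interpolate_eq_sum {ι : Type} [Fintype ι] [DecidableEq ι] (node : ι → (ℝ → ℝ) → ℝ)
    (φ : ι → ℝ[X]) (u : ℝ → ℝ) (x : ℝ) :
    interpolate node φ u x = ∑ j, node j u * (dualPoly node φ j).eval x := by
  simp [interpolate, dualPoly, eval_finsetSum]

theorem apply_dualPoly {ι : Type} [Fintype ι] [DecidableEq ι] {node : ι → (ℝ → ℝ) → ℝ}
    {φ : ι → ℝ[X]} {F : ι → ℝ[X] →ₗ[ℝ] ℝ} (hF : ∀ i p, node i (fun x => eval x p) = F i p)
    (hφ : LinearIndependent ℝ φ)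
    (h : ∀ c : ι → ℝ, (∀ i, F i (∑ j, c j • φ j) = 0) → ∑ j, c j • φ j = 0) (i j : ι) :
    F i (dualPoly node φ j) = if i = j then 1 else 0 := by
  have hM : nodalMatrix node φ = Matrix.of fun i j => F i (φ j) := by
    ext; simp [nodalMatrix, hF]
  have hu := isUnit_of_unisolvent hφ h
  rw [← hM, Matrix.isUnit_iff_isUnit_det] at hu
  have := congrFun (congrFun (Matrix.mul_nonsing_inv _ hu) i) j
  rw [Matrix.mul_apply, Matrix.one_apply] at this
  rw [← this, dualPoly, map_sum]
  exact Finset.sum_congr rfl fun l _ => by rw [map_smul, hM, Matrix.of_apply, smul_eq_mul, mul_comm]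

/-- The shape functions: the polynomials dual to the node functionals, extended by zero for
`1`-forms so that the same index set serves for `0`-forms and `1`-forms. -/
def shape (m n : ℕ) (k : Fin 2) (j : Fin (n + 1)) : ℝ[X] :=
  if k = 0 then dualPoly (node0 m n) (basis0 m n) j
  else Fin.snoc (α := fun _ => ℝ[X]) (dualPoly (node1 m n) (basis1 m n)) 0 j

theorem natDegree_shape_le {m n : ℕ} (hn : 2 * m + 1 ≤ n) (k : Fin 2) (j : Fin (n + 1)) :
    (shape m n k j).natDegree ≤ n - k := by
  unfold shape
  split_ifs with h
  · subst h
    exact natDegree_sum_le_of_forall_le _ _ fun i _ =>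
      (natDegree_smul_le _ _).trans (natDegree_basis0_le hn i)
  · obtain rfl : k = 1 := by omega
    refine Fin.lastCases ?_ (fun j => ?_) j
    · simp
    · rw [Fin.snoc_castSucc]
      exact natDegree_sum_le_of_forall_le _ _ fun i _ =>
        (natDegree_smul_le _ _).trans (natDegree_basis1_le hn i)

theorem nodePoly_shape_zero {m n : ℕ} (hn : 2 * m + 1 ≤ n) (i j : Fin (n + 1)) :
    nodePoly m n 0 i (shape m n 0 j) = if i = j then 1 else 0 := by
  refine apply_dualPoly (F := fun i : Fin (n + 1) => nodePoly m n 0 i) (node0_eval m n)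
    (linearIndependent_basis0 hn) (fun c hc => unisolvent_zero hn ?_ fun j hj =>
      hc ⟨j, Nat.lt_succ_of_le hj⟩) i j
  refine degree_le_natDegree.trans_lt (Nat.cast_lt.2 (Nat.lt_succ_of_le ?_))
  exact natDegree_sum_le_of_forall_le _ _ fun i _ =>
      (natDegree_smul_le _ _).trans (natDegree_basis0_le hn i)

theorem nodePoly_shape_one {m n : ℕ} (hn : 2 * m + 1 ≤ n) (i : Fin n) (j : Fin (n + 1)) :
    nodePoly m n 1 i (shape m n 1 j) = if i.castSucc = j then 1 else 0 := by
  rw [shape, if_neg (by simp)]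
  refine Fin.lastCases ?_ (fun j => ?_) j
  · simp
  rw [Fin.snoc_castSucc, apply_dualPoly (F := fun i : Fin n => nodePoly m n 1 i) (node1_eval m n)
    (linearIndependent_basis1 hn) (fun c hc => unisolvent_one hn ?_ fun j hj => hc ⟨j, hj⟩) i j]
  · simp
  refine degree_le_natDegree.trans_lt (Nat.cast_lt.2 ((Nat.le_sub_one_iff_lt (by omega)).1 ?_))
  exact natDegree_sum_le_of_forall_le _ _ fun i _ =>
      (natDegree_smul_le _ _).trans (natDegree_basis1_le hn i)

theorem shape_one_last (m n : ℕ) : shape m n 1 (Fin.last n) = 0 := by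
  simp [shape]

/-- The one-dimensional cochain property: both sides have degree below `n` and the same `1`-form
node values, by `nodePoly_derivative` and duality. -/
theorem derivative_shape {m n : ℕ} (hn : 2 * m + 1 ≤ n) (j : Fin (n + 1)) :
    derivative (shape m n 0 j) = shape m n 1 j := by
  rw [← sub_eq_zero]
  refine unisolvent_one hn ?_ fun i hi => ?_
  · refine degree_le_natDegree.trans_lt (Nat.cast_lt.2 ((Nat.le_sub_one_iff_lt (by omega)).1 ?_))
    refine (natDegree_sub_le _ _).trans (max_le ?_ (natDegree_shape_le hn 1 j))
    exact (natDegree_derivative_le _).trans (Nat.sub_le_sub_right (natDegree_shape_le hn 0 j) 1)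
  · have h0 := nodePoly_shape_zero hn (Fin.castSucc ⟨i, hi⟩) j
    have h1 := nodePoly_shape_one hn ⟨i, hi⟩ j
    simp only [Fin.val_castSucc] at h0
    rw [map_sub, nodePoly_derivative hi, h0, h1, sub_self]

/-! ### One-dimensional interpolation through shape functions -/

/-- For `k = 1` the term of index `n` carries a meaningless functional, but its shape function is
zero. -/
theorem IsJetInterval.interp_eq {u : ℕ → ℝ → ℝ} (hu : IsJetInterval u) (m n : ℕ) (k : Fin 2)
    (x : ℝ) :
    interp m n k (u 0) x = ∑ j : Fin (n + 1), nodeFun m n k j u * (shape m n k j).eval x := by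
  unfold interp shape
  split_ifs with h
  · subst h
    rw [interpolate_eq_sum]
    simp [hu.node0_eq]
  · obtain rfl : k = 1 := by omega
    rw [interpolate_eq_sum, Fin.sum_univ_castSucc]
    simp [hu.node1_eq]

/-- The difference between `p` and its interpolant is killed by all node functionals, so unisolvence
applies. -/
theorem interp_eval {m n : ℕ} (hn : 2 * m + 1 ≤ n) (k : Fin 2) {p : ℝ[X]}
    (hp : p.natDegree ≤ n - k) (x : ℝ) : interp m n k (fun t => p.eval t) x = p.eval x := by
  have h := (isJetInterval_polyJet p).interp_eq m n k x
  refine (show _ = _ from h).trans ?_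
  have hs : p = ∑ j : Fin (n + 1), nodePoly m n k j p • shape m n k j := by
    rw [← sub_eq_zero]
    have hdeg : (p - ∑ j : Fin (n + 1), nodePoly m n k j p • shape m n k j).natDegree ≤ n - k :=
      (natDegree_sub_le _ _).trans (max_le hp (natDegree_sum_le_of_forall_le _ _ fun i _ =>
        (natDegree_smul_le _ _).trans (natDegree_shape_le hn k i)))
    obtain rfl | rfl : k = 0 ∨ k = 1 := by omega
    · refine unisolvent_zero hn
        (degree_le_natDegree.trans_lt (Nat.cast_lt.2 (Nat.lt_succ_of_le hdeg))) fun i hi => ?_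
      have hd := nodePoly_shape_zero hn ⟨i, Nat.lt_succ_of_le hi⟩
      simp only at hd
      simp only [map_sub, map_sum, map_smul, Fin.val_zero, hd]
      simp
    · refine unisolvent_one hn (degree_le_natDegree.trans_lt
        (Nat.cast_lt.2 ((Nat.le_sub_one_iff_lt (by omega)).1 hdeg))) fun i hi => ?_
      have hd := nodePoly_shape_one hn ⟨i, hi⟩
      simp only at hd
      simp only [map_sub, map_sum, map_smul, Fin.val_one, hd]
      simp
  conv_rhs => rw [hs, eval_finsetSum]
  simp only [eval_smul, smul_eq_mul]
  rfl

/-- The tensor product operator feeds an outer interpolation with functions that are controlled on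
`[0, 1]` only. Replacing the first member of the jet by `f` leaves a jet, as all derivatives are
taken within the interval. -/
theorem IsJetInterval.interp_eq_of_eqOn {u : ℕ → ℝ → ℝ} (hu : IsJetInterval u) {f : ℝ → ℝ}
    (hf : EqOn f (u 0) (Icc 0 1)) (m n : ℕ) (k : Fin 2) (x : ℝ) :
    interp m n k f x = ∑ j : Fin (n + 1), nodeFun m n k j u * (shape m n k j).eval x := by
  set v : ℕ → ℝ → ℝ := Function.update u 0 f with hv
  have hvu : ∀ k, EqOn (v k) (u k) (Icc 0 1) := by
    rintro (_ | k) t ht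
    · simpa [hv] using hf ht
    · simp [hv]
  have hvj : IsJetInterval v := fun k t ht => by
    rw [hvu (k + 1) ht]
    exact (hu k t ht).congr (hvu k) (hvu k ht)
  have h := hvj.interp_eq m n k x
  rw [show v 0 = f by simp [hv]] at h
  rw [h]
  refine Finset.sum_congr rfl fun j _ => ?_
  congr 1
  refine integral_congr_ae ?_
  filter_upwards [ae_nodeMeasure_mem m n j] with t ht
  rw [hvu _ ht]

/-! ### Reproduction of end point derivatives -/

/-- A derivative at an end point that is a combination of the node functionals is reproduced by
the shape functions. -/
theorem derivative_shape_eq_of_forall {m n : ℕ} (hn : 2 * m + 1 ≤ n) {k : Fin 2} {γ : ℕ} {a : ℝ}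
    {c : Fin (n + 1) → ℝ} (hlast : k = 1 → c (Fin.last n) = 0)
    (hc : ∀ u, IsJetInterval u → u γ a = ∑ j, c j * nodeFun m n k j u) (j : Fin (n + 1)) :
    (derivative^[γ] (shape m n k j)).eval a = c j := by
  -- The representation is tested on the shape function itself, where duality picks out one
  -- coefficient.
  have h := hc _ (isJetInterval_polyJet (shape m n k j))
  refine (show _ = _ from h).trans ?_
  change ∑ i : Fin (n + 1), c i * nodePoly m n k i (shape m n k j) = c j
  obtain rfl | rfl : k = 0 ∨ k = 1 := by omega
  · have := fun i => nodePoly_shape_zero hn i j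
    simp only [Fin.val_zero, this]
    simp
  · have := fun i => nodePoly_shape_one hn i j
    rw [Fin.sum_univ_castSucc, hlast rfl]
    simp only [Fin.val_one, Fin.val_castSucc, this]
    refine Fin.lastCases ?_ (fun j => ?_) j
    · simp [hlast rfl]
    · simp

/-- For `γ + k ≥ 1` the trace is itself a node functional. For `γ = k = 0` the two values are half
the sum plus or minus half the difference of `u 0 1` and `u 0 0`, both of which are node
functionals. -/
theorem exists_trace_eq_sum_nodeFun {m n : ℕ} (hn : 2 * m + 1 ≤ n) {k : Fin 2} {γ : ℕ}
    (hγ : γ + k ≤ m) {a : ℝ} (ha : a = 0 ∨ a = 1) :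
    ∃ c : Fin (n + 1) → ℝ, (k = 1 → c (Fin.last n) = 0) ∧
      ∀ u, IsJetInterval u → u γ a = ∑ j, c j * nodeFun m n k j u := by
  by_cases hpos : 1 ≤ γ + k
  · obtain ⟨i, hi⟩ : ∃ i, i + 1 = γ + k := ⟨γ + k - 1, by omega⟩
    have hγi : i + 1 - k = γ := by omega
    rcases ha with rfl | rfl
    · refine ⟨Pi.single ⟨2 * i, by omega⟩ 1, fun _ => ?_, fun u _ => ?_⟩
      · rw [Pi.single_eq_of_ne]
        exact Fin.ne_of_val_ne (by simp; omega)
      · rw [Finset.sum_eq_single_of_mem ⟨2 * i, by omega⟩ (Finset.mem_univ _)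
          fun j _ hj => by rw [Pi.single_eq_of_ne hj, zero_mul]]
        rw [Pi.single_eq_same, one_mul, nodeFun_left (by omega), hγi]
    · refine ⟨Pi.single ⟨2 * i + 1, by omega⟩ 1, fun _ => ?_, fun u _ => ?_⟩
      · rw [Pi.single_eq_of_ne]
        exact Fin.ne_of_val_ne (by simp; omega)
      · rw [Finset.sum_eq_single_of_mem ⟨2 * i + 1, by omega⟩ (Finset.mem_univ _)
          fun j _ hj => by rw [Pi.single_eq_of_ne hj, zero_mul]]
        rw [Pi.single_eq_same, one_mul, nodeFun_right (by omega), hγi]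
  · obtain rfl : γ = 0 := by omega
    obtain rfl : k = 0 := by omega
    have hsum (b : ℝ) (u : ℕ → ℝ → ℝ) (hu : IsJetInterval u) :
        ∑ j : Fin (n + 1), (Pi.single (Fin.last n) (1 / 2) + Pi.single ⟨2 * m, by omega⟩ b
          : Fin (n + 1) → ℝ) j * nodeFun m n 0 j u
          = 1 / 2 * (u 0 0 + u 0 1) + b * (u 0 1 - u 0 0) := by
      simp only [Pi.add_apply, add_mul, Finset.sum_add_distrib]
      rw [Finset.sum_eq_single_of_mem (Fin.last n) (Finset.mem_univ _)
          fun j _ hj => by rw [Pi.single_eq_of_ne hj, zero_mul],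
        Finset.sum_eq_single_of_mem ⟨2 * m, by omega⟩ (Finset.mem_univ _)
          fun j _ hj => by rw [Pi.single_eq_of_ne hj, zero_mul]]
      rw [Pi.single_eq_same, Pi.single_eq_same, Fin.val_last, nodeFun_zero_last hn,
        hu.nodeFun_zero_mean hn]
    rcases ha with rfl | rfl
    · exact ⟨_, fun h => absurd h zero_ne_one, fun u hu =>
        (show u 0 0 = _ by ring).trans (hsum (-(1 / 2)) u hu).symm⟩
    · exact ⟨_, fun h => absurd h zero_ne_one, fun u hu =>
        (show u 0 1 = _ by ring).trans (hsum (1 / 2) u hu).symm⟩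

/-- Interpolation reproduces the derivatives of order at most `m - k` at the end points. -/
theorem IsJetInterval.sum_nodeFun_mul_derivative_shape {u : ℕ → ℝ → ℝ} (hu : IsJetInterval u)
    {m n : ℕ} (hn : 2 * m + 1 ≤ n) {k : Fin 2} {γ : ℕ} (hγ : γ + k ≤ m) {a : ℝ}
    (ha : a = 0 ∨ a = 1) :
    ∑ j : Fin (n + 1), nodeFun m n k j u * (derivative^[γ] (shape m n k j)).eval a = u γ a := by
  obtain ⟨c, hlast, hc⟩ := exists_trace_eq_sum_nodeFun hn hγ ha
  simp only [derivative_shape_eq_of_forall hn hlast hc]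
  rw [hc u hu]
  exact Finset.sum_congr rfl fun j _ => mul_comm _ _

/-! ### Jets on the cube -/

theorem mem_cube {N : ℕ} {x : Fin N → ℝ} : x ∈ cube N ↔ ∀ l, x l ∈ Icc (0 : ℝ) 1 := by
  simp [cube, Pi.le_def, forall_and]

theorem isCompact_cube (N : ℕ) : IsCompact (cube N) := isCompact_Icc

theorem update_mem_cube {N : ℕ} {x : Fin N → ℝ} (hx : x ∈ cube N) (l : Fin N) {t : ℝ}
    (ht : t ∈ Icc (0 : ℝ) 1) : Function.update x l t ∈ cube N := by
  rw [mem_cube] at hx ⊢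
  intro q
  rcases eq_or_ne q l with rfl | hq
  · simpa using ht
  · simpa [hq] using hx q

theorem insertNth_mem_cube {N : ℕ} {l : Fin (N + 1)} {t : ℝ} {y : Fin N → ℝ}
    (ht : t ∈ Icc (0 : ℝ) 1) (hy : y ∈ cube N) :
    (l.insertNth t y : Fin (N + 1) → ℝ) ∈ cube (N + 1) := by
  rw [mem_cube] at hy ⊢
  rw [Fin.forall_iff_succAbove l]
  simpa using ⟨ht, hy⟩

/-- A family of functions on the cube, indexed by multi-indices, that are the successive partial
derivatives of the first one. -/
structure IsJet {N : ℕ} (D : (Fin N → ℕ) → (Fin N → ℝ) → ℝ) : Prop where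
  continuousOn : ∀ α, ContinuousOn (D α) (cube N)
  hasDerivWithinAt : ∀ α l, ∀ x ∈ cube N, HasDerivWithinAt (fun t => D α (Function.update x l t))
    (D (α + Pi.single l 1) x) (Icc 0 1) (x l)

/-- The restriction of a jet to a face parallel to `x_l = 0`, with normal derivative of order
`a`. -/
def faceJet {N : ℕ} (D : (Fin (N + 1) → ℕ) → (Fin (N + 1) → ℝ) → ℝ) (l : Fin (N + 1)) (a : ℕ)
    (t : ℝ) (β : Fin N → ℕ) (y : Fin N → ℝ) : ℝ := D (l.insertNth a β) (l.insertNth t y)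

theorem insertNth_add_single_succAbove {N : ℕ} (l : Fin (N + 1)) (q : Fin N) (a : ℕ)
    (β : Fin N → ℕ) : (l.insertNth a (β + Pi.single q 1) : Fin (N + 1) → ℕ)
      = l.insertNth a β + Pi.single (l.succAbove q) 1 := by
  refine Fin.insertNth_eq_iff.2 ⟨by simp, ?_⟩
  funext i
  simp [Fin.removeNth, Pi.single_apply]

theorem insertNth_add_single_same {N : ℕ} (l : Fin (N + 1)) (a : ℕ) (β : Fin N → ℕ) :
    (l.insertNth (a + 1) β : Fin (N + 1) → ℕ) = l.insertNth a β + Pi.single l 1 := by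
  refine Fin.insertNth_eq_iff.2 ⟨by simp, ?_⟩
  funext i
  simp [Fin.removeNth]

theorem IsJet.face {N : ℕ} {D : (Fin (N + 1) → ℕ) → (Fin (N + 1) → ℝ) → ℝ} (hD : IsJet D)
    (l : Fin (N + 1)) (a : ℕ) {t : ℝ} (ht : t ∈ Icc (0 : ℝ) 1) : IsJet (faceJet D l a t) where
  continuousOn β := by
    refine (hD.continuousOn _).comp (Continuous.continuousOn ?_)
      fun y hy => insertNth_mem_cube ht hy
    exact continuous_const.finInsertNth l continuous_id
  hasDerivWithinAt β q y hy := by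
    have h := hD.hasDerivWithinAt (l.insertNth a β) (l.succAbove q) _
      (insertNth_mem_cube (l := l) ht hy)
    simp only [Fin.insertNth_apply_succAbove, ← Fin.insertNth_update,
      ← insertNth_add_single_succAbove] at h
    exact h

theorem IsJet.hasDerivWithinAt_faceJet {N : ℕ} {D : (Fin (N + 1) → ℕ) → (Fin (N + 1) → ℝ) → ℝ}
    (hD : IsJet D) (l : Fin (N + 1)) (a : ℕ) (β : Fin N → ℕ) {y : Fin N → ℝ} (hy : y ∈ cube N)
    {t : ℝ} (ht : t ∈ Icc (0 : ℝ) 1) :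
    HasDerivWithinAt (fun s => faceJet D l a s β y) (faceJet D l (a + 1) t β y) (Icc 0 1) t := by
  have h := hD.hasDerivWithinAt (l.insertNth a β) l _ (insertNth_mem_cube (l := l) ht hy)
  simp only [Fin.insertNth_apply_same, Fin.update_insertNth, ← insertNth_add_single_same] at h
  exact h

theorem IsJet.add {N : ℕ} {D E : (Fin N → ℕ) → (Fin N → ℝ) → ℝ} (hD : IsJet D) (hE : IsJet E) :
    IsJet (D + E) where
  continuousOn α := (hD.continuousOn α).add (hE.continuousOn α)
  hasDerivWithinAt α l x hx := (hD.hasDerivWithinAt α l x hx).add (hE.hasDerivWithinAt α l x hx)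

theorem IsJet.const_smul {N : ℕ} {D : (Fin N → ℕ) → (Fin N → ℝ) → ℝ} (hD : IsJet D) (c : ℝ) :
    IsJet (c • D) where
  continuousOn α := (hD.continuousOn α).const_smul c
  hasDerivWithinAt α l x hx := (hD.hasDerivWithinAt α l x hx).const_smul c

theorem isJet_zero (N : ℕ) : IsJet (0 : (Fin N → ℕ) → (Fin N → ℝ) → ℝ) where
  continuousOn _ := continuousOn_const
  hasDerivWithinAt _ _ _ _ := hasDerivWithinAt_const ..

theorem isJet_sum {N : ℕ} {ι : Type*} (s : Finset ι) {D : ι → (Fin N → ℕ) → (Fin N → ℝ) → ℝ}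
    (hD : ∀ i ∈ s, IsJet (D i)) : IsJet (∑ i ∈ s, D i) :=
  Finset.sum_induction _ IsJet (fun _ _ => IsJet.add) (isJet_zero N) hD

theorem IsJet.shift {N : ℕ} {D : (Fin N → ℕ) → (Fin N → ℝ) → ℝ} (hD : IsJet D)
    (β : Fin N → ℕ) : IsJet fun α => D (α + β) where
  continuousOn α := hD.continuousOn _
  hasDerivWithinAt α l x hx := by
    rw [add_right_comm]
    exact hD.hasDerivWithinAt (α + β) l x hx

/-- A jet is determined on the cube by its first member. -/
theorem IsJet.eqOn {N : ℕ} {D E : (Fin N → ℕ) → (Fin N → ℝ) → ℝ} (hD : IsJet D) (hE : IsJet E)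
    (h : EqOn (D 0) (E 0) (cube N)) (α : Fin N → ℕ) : EqOn (D α) (E α) (cube N) := by
  induction hd : ∑ l, α l generalizing α with
  | zero =>
    have : α = 0 := by
      funext l
      exact (Finset.sum_eq_zero_iff.1 hd) l (Finset.mem_univ l)
    rwa [this]
  | succ d ih =>
    obtain ⟨l, -, hl⟩ : ∃ l ∈ Finset.univ, α l ≠ 0 := by
      apply Finset.exists_ne_zero_of_sum_ne_zero
      omega
    -- One derivative in a direction that occurs in `α` is split off; the one-dimensional derivative
    -- within `[0, 1]` is unique up to the end points.
    obtain ⟨β, rfl⟩ : ∃ β, α = β + Pi.single l 1 :=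
      ⟨α - Pi.single l 1, (tsub_add_cancel_of_le fun q => by
        rcases eq_or_ne q l with rfl | hq
        · rw [Pi.single_eq_same]; exact Nat.one_le_iff_ne_zero.2 hl
        · rw [Pi.single_eq_of_ne hq]; exact Nat.zero_le _).symm⟩
    have hβ := ih β (by simpa [Finset.sum_add_distrib, Pi.single_apply] using hd)
    intro x hx
    have hx' := mem_cube.1 hx l
    refine (uniqueDiffOn_Icc zero_lt_one _ hx').eq_deriv _ (hD.hasDerivWithinAt β l x hx)
      ((hE.hasDerivWithinAt β l x hx).congr (fun t ht => hβ (update_mem_cube hx l ht)) ?_)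
    rw [Function.update_eq_self]
    exact hβ hx

/-! ### Tensor products of node functionals -/

/-- The tensor product of the node functionals with indices `J l` for `k l`-forms, as a functional
on jets. -/
def tensorNode (m n : ℕ) {N : ℕ} (k : Fin N → Fin 2) (J : Fin N → Fin (n + 1))
    (D : (Fin N → ℕ) → (Fin N → ℝ) → ℝ) : ℝ :=
  ∫ y, (∏ l, (nodeWeight m n (J l)).eval (y l)) * D (fun l => nodeOrder m n (J l) - k l) y
    ∂Measure.pi fun l => nodeMeasure m n (J l)

theorem ae_pi_nodeMeasure_mem (m n : ℕ) {N : ℕ} (J : Fin N → Fin (n + 1)) :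
    ∀ᵐ y ∂Measure.pi fun l => nodeMeasure m n (J l), y ∈ cube N := by
  simp only [mem_cube]
  exact ae_all_iff.2 fun l => Measure.tendsto_eval_ae_ae.eventually (ae_nodeMeasure_mem m n (J l))

theorem continuous_prod_nodeWeight (m n : ℕ) {N : ℕ} (J : Fin N → Fin (n + 1)) :
    Continuous fun y : Fin N → ℝ => ∏ l, (nodeWeight m n (J l)).eval (y l) :=
  continuous_finsetProd _ fun l _ => (Polynomial.continuous _).comp (continuous_apply l)

theorem integrable_tensorNode (m n : ℕ) {N : ℕ} (J : Fin N → Fin (n + 1))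
    {g : (Fin N → ℝ) → ℝ} (hg : ContinuousOn g (cube N)) :
    Integrable (fun y => (∏ l, (nodeWeight m n (J l)).eval (y l)) * g y)
      (Measure.pi fun l => nodeMeasure m n (J l)) :=
  integrable_of_continuousOn_of_ae_mem (isCompact_cube N) (ae_pi_nodeMeasure_mem m n J)
    ((continuous_prod_nodeWeight m n J).continuousOn.mul hg)

theorem tensorNode_congr {m n N : ℕ} {k : Fin N → Fin 2} {J : Fin N → Fin (n + 1)}
    {D E : (Fin N → ℕ) → (Fin N → ℝ) → ℝ} (h : ∀ α, EqOn (D α) (E α) (cube N)) :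
    tensorNode m n k J D = tensorNode m n k J E := by
  refine integral_congr_ae ?_
  filter_upwards [ae_pi_nodeMeasure_mem m n J] with y hy
  rw [h _ hy]

theorem tensorNode_add {m n N : ℕ} {k : Fin N → Fin 2} {J : Fin N → Fin (n + 1)}
    {D E : (Fin N → ℕ) → (Fin N → ℝ) → ℝ} (hD : IsJet D) (hE : IsJet E) :
    tensorNode m n k J (D + E) = tensorNode m n k J D + tensorNode m n k J E := by
  unfold tensorNode
  rw [← integral_add (integrable_tensorNode m n J (hD.continuousOn _))
    (integrable_tensorNode m n J (hE.continuousOn _))]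
  simp [mul_add]

theorem tensorNode_smul {m n N : ℕ} {k : Fin N → Fin 2} {J : Fin N → Fin (n + 1)}
    (D : (Fin N → ℕ) → (Fin N → ℝ) → ℝ) (c : ℝ) :
    tensorNode m n k J (c • D) = c * tensorNode m n k J D := by
  unfold tensorNode
  rw [← integral_const_mul]
  simp [mul_left_comm]

/-- Differentiation under the integral sign, up to the end points of the parameter interval. -/
theorem hasDerivWithinAt_integral_of_bounded {α : Type*} [MeasurableSpace α] {μ : Measure α}
    [IsFiniteMeasure μ] {F F' : ℝ → α → ℝ} {c : ℝ} {s : Set ℝ} (hs : Convex ℝ s)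
    (hF : ∀ t ∈ s, Integrable (F t) μ)
    (hF' : ∀ᵐ y ∂μ, ∀ t ∈ s, HasDerivWithinAt (fun r => F r y) (F' t y) s t ∧ ‖F' t y‖ ≤ c)
    {t : ℝ} (ht : t ∈ s) :
    HasDerivWithinAt (fun r => ∫ y, F r y ∂μ) (∫ y, F' t y ∂μ) s t := by
  rw [hasDerivWithinAt_iff_tendsto_slope]
  have hslope : ∀ r ∈ s, slope (fun r => ∫ y, F r y ∂μ) t r = ∫ y, slope (fun r => F r y) t r ∂μ := by
    intro r hr
    simp only [slope_def_module]
    rw [integral_smul, integral_sub (hF r hr) (hF t ht)]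
  have hmem : ∀ᶠ r in nhdsWithin t (s \ {t}), r ∈ s \ {t} := self_mem_nhdsWithin
  refine Filter.Tendsto.congr' (f₁ := fun r => ∫ y, slope (fun r => F r y) t r ∂μ) ?_ ?_
  · filter_upwards [hmem] with r hr using (hslope r hr.1).symm
  · refine tendsto_integral_filter_of_dominated_convergence (fun _ => c) ?_ ?_
      (integrable_const c) ?_
    · filter_upwards [hmem] with r hr
      simp only [slope_def_module]
      exact (((hF r hr.1).sub (hF t ht)).smul (r - t)⁻¹).aestronglyMeasurable
    · filter_upwards [hmem] with r hr
      filter_upwards [hF'] with y hy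
      -- The mean value inequality bounds every slope by `c`, the dominating constant.
      have h := hs.norm_image_sub_le_of_norm_hasDerivWithin_le (fun r hr => (hy r hr).1)
        (fun r hr => (hy r hr).2) ht hr.1
      have hpos : 0 < ‖r - t‖ := norm_pos_iff.2 (sub_ne_zero.2 hr.2)
      rw [slope_def_module, norm_smul, norm_inv, inv_mul_le_iff₀ hpos, mul_comm]
      exact h
    · filter_upwards [hF'] with y hy
      exact hasDerivWithinAt_iff_tendsto_slope.1 (hy t ht).1

theorem IsJet.exists_faceJet_bound {N : ℕ} {D : (Fin (N + 1) → ℕ) → (Fin (N + 1) → ℝ) → ℝ}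
    (hD : IsJet D) (l : Fin (N + 1)) (a : ℕ) (β : Fin N → ℕ) {w : (Fin N → ℝ) → ℝ}
    (hw : Continuous w) :
    ∃ c, ∀ t ∈ Icc (0 : ℝ) 1, ∀ y ∈ cube N, ‖w y * faceJet D l a t β y‖ ≤ c := by
  have hc : ContinuousOn (fun x : Fin (N + 1) → ℝ => w (l.removeNth x) * D (l.insertNth a β) x)
      (cube (N + 1)) := by
    refine ContinuousOn.mul (Continuous.continuousOn ?_) (hD.continuousOn _)
    exact hw.comp (continuous_pi fun i => continuous_apply _)
  obtain ⟨c, hc⟩ := (isCompact_cube (N + 1)).exists_bound_of_continuousOn hc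
  refine ⟨c, fun t ht y hy => ?_⟩
  simpa [faceJet] using hc _ (insertNth_mem_cube (l := l) ht hy)

/-- Applying functionals in all variables but the `l`-th leaves a jet in that variable, by
differentiation under the integral; compactness of the cube supplies the bound. -/
theorem IsJet.isJetInterval_tensorNode {N : ℕ} {D : (Fin (N + 1) → ℕ) → (Fin (N + 1) → ℝ) → ℝ}
    (hD : IsJet D) (m n : ℕ) (l : Fin (N + 1)) (k : Fin N → Fin 2) (J : Fin N → Fin (n + 1)) :
    IsJetInterval fun a t => tensorNode m n k J (faceJet D l a t) := by
  intro a t ht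
  set β : Fin N → ℕ := fun l => nodeOrder m n (J l) - k l
  obtain ⟨c, hc⟩ := hD.exists_faceJet_bound l (a + 1) β (continuous_prod_nodeWeight m n J)
  refine hasDerivWithinAt_integral_of_bounded (c := c)
    (F' := fun s y => (∏ l, (nodeWeight m n (J l)).eval (y l)) * faceJet D l (a + 1) s β y)
    (convex_Icc 0 1)
    (fun s hs => integrable_tensorNode m n J ((hD.face l a hs).continuousOn β)) ?_ ht
  filter_upwards [ae_pi_nodeMeasure_mem m n J] with y hy s hs
  exact ⟨(hD.hasDerivWithinAt_faceJet l a β hy hs).const_mul _, hc s hs y hy⟩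

/-- Fubini, with an arbitrary variable `l` singled out: the formula for the operator peels off the
first variable, the trace argument the normal one. -/
theorem IsJet.tensorNode_eq_nodeFun {N : ℕ} {D : (Fin (N + 1) → ℕ) → (Fin (N + 1) → ℝ) → ℝ}
    (hD : IsJet D) (m n : ℕ) (l : Fin (N + 1)) (k : Fin (N + 1) → Fin 2)
    (J : Fin (N + 1) → Fin (n + 1)) :
    tensorNode m n k J D = nodeFun m n (k l) (J l) fun a t =>
      tensorNode m n (l.removeNth k) (l.removeNth J) (faceJet D l a t) := by
  have hmp := (measurePreserving_piFinSuccAbove (fun l => nodeMeasure m n (J l)) l).symm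
  have hint := integrable_tensorNode m n J
    (hD.continuousOn fun l => nodeOrder m n (J l) - k l)
  have hord : (fun q => nodeOrder m n (J q) - (k q : ℕ)) = l.insertNth
      (nodeOrder m n (J l) - (k l : ℕ))
      (fun q => nodeOrder m n (J (l.succAbove q)) - (k (l.succAbove q) : ℕ)) :=
    (Fin.insertNth_self_removeNth l _).symm
  unfold tensorNode nodeFun
  rw [← hmp.integrable_comp_emb (MeasurableEquiv.measurableEmbedding _)] at hint
  rw [← hmp.integral_comp']
  refine (integral_prod _ hint).trans ?_
  refine integral_congr_ae (.of_forall fun t => ?_)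
  simp only [Function.comp_apply]
  rw [← integral_const_mul]
  refine integral_congr_ae (.of_forall fun y => ?_)
  simp only [MeasurableEquiv.piFinSuccAbove_symm_apply, Fin.insertNthEquiv, Equiv.coe_fn_mk]
  rw [Fin.prod_univ_succAbove _ l, hord]
  simp [faceJet, Fin.removeNth, mul_assoc]

theorem sum_insertNth {N : ℕ} {κ M : Type*} [Fintype κ] [AddCommMonoid M] (l : Fin (N + 1))
    (f : (Fin (N + 1) → κ) → M) :
    ∑ J, f J = ∑ J' : Fin N → κ, ∑ j : κ, f (l.insertNth j J') := by
  rw [← Equiv.sum_comp (Fin.insertNthEquiv (fun _ => κ) l), Fintype.sum_prod_type_right]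
  rfl

/-- The tensor product interpolation operator in terms of node functionals and shape functions. -/
theorem IsJet.tensorOp_interp_eq {N : ℕ} {D : (Fin N → ℕ) → (Fin N → ℝ) → ℝ} (hD : IsJet D)
    {f : (Fin N → ℝ) → ℝ} (hf : EqOn f (D 0) (cube N)) (m n : ℕ) (k : Fin N → Fin 2)
    (x : Fin N → ℝ) :
    tensorOp (fun l => interp m n (k l)) f x
      = ∑ J, tensorNode m n k J D * ∏ l, (shape m n (k l) (J l)).eval (x l) := by
  induction N with
  | zero =>
    have hx : x ∈ cube 0 := mem_cube.2 fun l => l.elim0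
    have hμ (J : Fin 0 → Fin (n + 1)) :
        (Measure.pi fun l => nodeMeasure m n (J l)) = Measure.dirac x := by
      rw [Measure.pi_of_empty _ x]
    simp only [tensorOp, Finset.univ_eq_empty, Finset.prod_empty, mul_one, tensorNode, one_mul, hμ,
      integral_dirac, Finset.univ_unique, Finset.sum_singleton]
    rw [hf hx]
    congr 1
    exact Subsingleton.elim _ _
  | succ N ih =>
    -- The inner interpolant at the fixed remaining coordinates of `x`, as a jet in the first
    -- variable.
    set u : ℕ → ℝ → ℝ := fun a t => ∑ J' : Fin N → Fin (n + 1),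
      tensorNode m n (Fin.removeNth 0 k) J' (faceJet D 0 a t)
        * ∏ l, (shape m n (k l.succ) (J' l)).eval (x l.succ) with hu
    have hjet := fun J' => hD.isJetInterval_tensorNode m n 0 (Fin.removeNth 0 k) J'
    have huj : IsJetInterval u := fun a t ht =>
      HasDerivWithinAt.fun_sum fun J' _ => (hjet J' a t ht).mul_const _
    rw [tensorOp, huj.interp_eq_of_eqOn]
    · rw [sum_insertNth 0, Finset.sum_comm]
      refine Finset.sum_congr rfl fun j _ => ?_
      have hnode : nodeFun m n (k 0) j u = ∑ J' : Fin N → Fin (n + 1),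
          tensorNode m n k (Fin.insertNth 0 j J') D
            * ∏ l, (shape m n (k l.succ) (J' l)).eval (x l.succ) := by
        simp only [hD.tensorNode_eq_nodeFun m n 0 k, Fin.insertNth_apply_same,
          Fin.removeNth_insertNth]
        unfold nodeFun
        simp only [hu, ← integral_mul_const]
        rw [← integral_finsetSum]
        · simp only [Finset.mul_sum, mul_assoc]
        · intro J' _
          exact ((hjet J').integrable m n j _).mul_const _
      rw [hnode, Finset.sum_mul]
      refine Finset.sum_congr rfl fun J' _ => ?_
      rw [Fin.prod_univ_succ]
      simp only [Fin.insertNth_zero', Fin.cons_zero, Fin.cons_succ]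
      ring
    · intro t ht
      refine ih (hD.face 0 0 ht) (fun y hy => ?_) (fun l => k l.succ) (Fin.tail x)
      rw [faceJet, Fin.insertNth_zero_right, Pi.single_zero, ← hf (insertNth_mem_cube ht hy),
        Fin.insertNth_zero']

/-! ### Jets of smooth functions -/

theorem interior_cube_nonempty (N : ℕ) : (interior (cube N)).Nonempty :=
  ⟨fun _ => 1 / 2, mem_interior_iff_mem_nhds.2
    (pi_Icc_mem_nhds (fun _ => by norm_num) (fun _ => by norm_num))⟩

theorem convex_cube (N : ℕ) : Convex ℝ (cube N) := convex_Icc 0 1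

theorem uniqueDiffOn_cube (N : ℕ) : UniqueDiffOn ℝ (cube N) :=
  uniqueDiffOn_convex (convex_cube N) (interior_cube_nonempty N)

/-- The partial derivative in the `l`-th variable of a function on the cube, through the Fréchet
derivative. -/
def dirDeriv {N : ℕ} (l : Fin N) (f : (Fin N → ℝ) → ℝ) (x : Fin N → ℝ) : ℝ :=
  fderivWithin ℝ f (cube N) x (Pi.single l 1)

theorem hasDerivWithinAt_dirDeriv {N : ℕ} {l : Fin N} {f : (Fin N → ℝ) → ℝ} {x : Fin N → ℝ}
    (hx : x ∈ cube N) (hf : DifferentiableWithinAt ℝ f (cube N) x) :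
    HasDerivWithinAt (fun t => f (Function.update x l t)) (dirDeriv l f x) (Icc 0 1) (x l) := by
  have h := hf.hasFDerivWithinAt
  rw [← Function.update_eq_self l x] at h
  have := h.comp_hasDerivWithinAt (x l) (hasDerivAt_update x l (x l)).hasDerivWithinAt
    (s := Icc 0 1) fun t ht => update_mem_cube hx l ht
  rwa [Function.update_eq_self] at this

theorem dirDeriv_eq {N : ℕ} {l : Fin N} {f : (Fin N → ℝ) → ℝ} {x : Fin N → ℝ}
    (hx : x ∈ cube N) (hf : DifferentiableWithinAt ℝ f (cube N) x) {d : ℝ}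
    (h : HasDerivWithinAt (fun t => f (Function.update x l t)) d (Icc 0 1) (x l)) :
    dirDeriv l f x = d :=
  (uniqueDiffOn_Icc zero_lt_one _ (mem_cube.1 hx l)).eq_deriv _ (hasDerivWithinAt_dirDeriv hx hf) h

theorem dirDeriv_congr {N : ℕ} {l : Fin N} {f g : (Fin N → ℝ) → ℝ} (h : EqOn f g (cube N)) :
    EqOn (dirDeriv l f) (dirDeriv l g) (cube N) := fun x hx => by
  rw [dirDeriv, fderivWithin_congr h (h hx), dirDeriv]

theorem contDiffOn_dirDeriv {N : ℕ} (l : Fin N) {f : (Fin N → ℝ) → ℝ}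
    (hf : ContDiffOn ℝ ∞ f (cube N)) : ContDiffOn ℝ ∞ (dirDeriv l f) (cube N) :=
  (hf.fderivWithin (uniqueDiffOn_cube N) (m := ∞) (by simp)).clm_apply contDiffOn_const

/-- Second derivatives within the cube are symmetric also at boundary points, since the cube lies in
the closure of its interior. -/
theorem dirDeriv_comm {N : ℕ} (l q : Fin N) {f : (Fin N → ℝ) → ℝ}
    (hf : ContDiffOn ℝ ∞ f (cube N)) :
    EqOn (dirDeriv l (dirDeriv q f)) (dirDeriv q (dirDeriv l f)) (cube N) := by
  intro x hx
  have hu := uniqueDiffOn_cube N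
  have hcl : x ∈ closure (interior (cube N)) := by
    rw [(convex_cube N).closure_interior_eq_closure_of_nonempty_interior (interior_cube_nonempty N)]
    exact subset_closure hx
  have hd : DifferentiableWithinAt ℝ (fderivWithin ℝ f (cube N)) (cube N) x :=
    (hf.fderivWithin hu (m := ∞) (by simp)).differentiableOn (by simp) x hx
  have hsnd (i j : Fin N) : dirDeriv i (dirDeriv j f) x =
      fderivWithin ℝ (fderivWithin ℝ f (cube N)) (cube N) x (Pi.single i 1) (Pi.single j 1) := by
    unfold dirDeriv
    rw [fderivWithin_clm_apply (hu x hx) hd (differentiableWithinAt_const _)]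
    simp
  rw [hsnd, hsnd]
  exact ((hf x hx).isSymmSndFDerivWithinAt
    (by simpa using WithTop.coe_le_coe.2 (le_top : (2 : ℕ∞) ≤ ⊤)) hu hcl hx).eq _ _

/-- Iterated partial derivatives along a list of variables. -/
def listDeriv {N : ℕ} (f : (Fin N → ℝ) → ℝ) (L : List (Fin N)) : (Fin N → ℝ) → ℝ :=
  L.foldr dirDeriv f

theorem contDiffOn_listDeriv {N : ℕ} {f : (Fin N → ℝ) → ℝ} (hf : ContDiffOn ℝ ∞ f (cube N))
    (L : List (Fin N)) : ContDiffOn ℝ ∞ (listDeriv f L) (cube N) := by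
  induction L with
  | nil => exact hf
  | cons l L ih => exact contDiffOn_dirDeriv l ih

theorem listDeriv_perm {N : ℕ} {f : (Fin N → ℝ) → ℝ} (hf : ContDiffOn ℝ ∞ f (cube N))
    {L L' : List (Fin N)} (h : L.Perm L') : EqOn (listDeriv f L) (listDeriv f L') (cube N) := by
  induction h with
  | nil => exact fun _ _ => rfl
  | cons l _ ih => exact dirDeriv_congr ih
  | swap l q L => exact dirDeriv_comm q l (contDiffOn_listDeriv hf L)
  | trans _ _ ih ih' => exact ih.trans ih'

/-- The family of partial derivatives of a smooth function on the cube. -/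
def smoothJet {N : ℕ} (f : (Fin N → ℝ) → ℝ) (α : Fin N → ℕ) : (Fin N → ℝ) → ℝ :=
  listDeriv f (∑ l, Multiset.replicate (α l) l).toList

theorem smoothJet_zero {N : ℕ} (f : (Fin N → ℝ) → ℝ) : smoothJet f 0 = f := by
  simp [smoothJet, listDeriv]

theorem isJet_smoothJet {N : ℕ} {f : (Fin N → ℝ) → ℝ} (hf : ContDiffOn ℝ ∞ f (cube N)) :
    IsJet (smoothJet f) where
  continuousOn α := (contDiffOn_listDeriv hf _).continuousOn
  hasDerivWithinAt α l x hx := by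
    have h := hasDerivWithinAt_dirDeriv (l := l) hx
      ((contDiffOn_listDeriv hf (∑ l, Multiset.replicate (α l) l).toList).differentiableOn
        (by simp) x hx)
    -- `Multiset.toList` chooses an arbitrary order, so the two lists agree only up to permutation.
    have hperm : (l :: (∑ q, Multiset.replicate (α q) q).toList).Perm
        (∑ q, Multiset.replicate ((α + Pi.single l 1 : Fin N → ℕ) q) q).toList := by
      rw [← Multiset.coe_eq_coe, ← Multiset.cons_coe, Multiset.coe_toList, Multiset.coe_toList]
      simp only [Pi.add_apply, Multiset.replicate_add, Finset.sum_add_distrib]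
      rw [Finset.sum_eq_single_of_mem
        (f := fun q => Multiset.replicate ((Pi.single l 1 : Fin N → ℕ) q) q) l
        (Finset.mem_univ l) (fun q _ hq => by simp [Pi.single_eq_of_ne hq]), Pi.single_eq_same,
        Multiset.replicate_one, add_comm, Multiset.singleton_add]
    exact h.congr_deriv (listDeriv_perm hf hperm hx)

theorem dirDeriv_eq_smoothJet {N : ℕ} {f : (Fin N → ℝ) → ℝ} (hf : ContDiffOn ℝ ∞ f (cube N))
    (l : Fin N) : EqOn (dirDeriv l f) (smoothJet f (Pi.single l 1)) (cube N) := fun x hx => by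
  have h := (isJet_smoothJet hf).hasDerivWithinAt 0 l x hx
  rw [smoothJet_zero, zero_add] at h
  exact dirDeriv_eq hx (hf.differentiableOn (by simp) x hx) h

/-! ### Properties of the tensor product interpolation operator -/

theorem prod_eval_update {N : ℕ} (p : Fin N → ℝ[X]) (x : Fin N → ℝ) (l : Fin N) (t : ℝ) :
    ∏ q, (p q).eval (Function.update x l t q)
      = (p l).eval t * ∏ q ∈ Finset.univ.erase l, (p q).eval (x q) := by
  rw [← Finset.mul_prod_erase _ _ (Finset.mem_univ l), Function.update_self]
  congr 1
  refine Finset.prod_congr rfl fun q hq => ?_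
  rw [Function.update_of_ne (Finset.ne_of_mem_erase hq)]

theorem IsJet.contDiff_tensorOp {N : ℕ} {D : (Fin N → ℕ) → (Fin N → ℝ) → ℝ} (hD : IsJet D)
    {f : (Fin N → ℝ) → ℝ} (hf : EqOn f (D 0) (cube N)) (m n : ℕ) (k : Fin N → Fin 2) :
    ContDiff ℝ ∞ (tensorOp (fun l => interp m n (k l)) f) := by
  rw [funext (hD.tensorOp_interp_eq hf m n k)]
  refine ContDiff.sum fun J _ => contDiff_const.mul (contDiff_prod fun l _ => ?_)
  exact (shape m n (k l) (J l)).contDiff_aeval ∞ |>.comp (contDiff_apply ℝ ℝ l)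

/-- The order lowered by `k l = 1` is restored by the extra derivative; index `n` is excluded
because its order is already `0`. -/
theorem tensorNode_shift {m n N : ℕ} {k : Fin N → Fin 2} {l : Fin N} (hk : k l = 1)
    {J : Fin N → Fin (n + 1)} (hJ : (J l : ℕ) < n) (D : (Fin N → ℕ) → (Fin N → ℝ) → ℝ) :
    tensorNode m n k J (fun α => D (α + Pi.single l 1))
      = tensorNode m n (Function.update k l 0) J D := by
  have hord : (fun q => nodeOrder m n (J q) - (k q : ℕ)) + Pi.single l 1
      = fun q => nodeOrder m n (J q) - (Function.update k l 0 q : ℕ) := by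
    funext q
    rcases eq_or_ne q l with rfl | hq
    · have := nodeOrder_pos (m := m) hJ
      simp [hk]
      omega
    · simp [hq]
  simp only [tensorNode, hord]

/-- Tensor product interpolation intertwines partial derivatives. -/
theorem IsJet.hasDerivAt_tensorOp {N : ℕ} {D : (Fin N → ℕ) → (Fin N → ℝ) → ℝ} (hD : IsJet D)
    {f g : (Fin N → ℝ) → ℝ} (hf : EqOn f (D 0) (cube N)) {l : Fin N}
    (hg : EqOn g (D (Pi.single l 1)) (cube N)) {m n : ℕ} (hn : 2 * m + 1 ≤ n)
    {k : Fin N → Fin 2} (hk : k l = 1) (x : Fin N → ℝ) :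
    HasDerivAt (fun t => tensorOp (fun q => interp m n (Function.update k l 0 q)) f
      (Function.update x l t)) (tensorOp (fun q => interp m n (k q)) g x) (x l) := by
  rw [(hD.shift (Pi.single l 1)).tensorOp_interp_eq (by rwa [zero_add])]
  simp only [hD.tensorOp_interp_eq hf, prod_eval_update]
  refine HasDerivAt.fun_sum fun J _ => ?_
  have h := (((shape m n (Function.update k l 0 l) (J l)).hasDerivAt (x l)).mul_const
    (∏ q ∈ Finset.univ.erase l,
      (shape m n (Function.update k l 0 q) (J q)).eval (x q))).const_mul
    (tensorNode m n (Function.update k l 0) J D)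
  refine h.congr_deriv ?_
  rw [Function.update_self, derivative_shape hn]
  have hprod : ∏ q, (shape m n (k q) (J q)).eval (x q) = (shape m n 1 (J l)).eval (x l) *
      ∏ q ∈ Finset.univ.erase l, (shape m n (Function.update k l 0 q) (J q)).eval (x q) := by
    rw [← Finset.mul_prod_erase _ _ (Finset.mem_univ l), hk]
    congr 1
    refine Finset.prod_congr rfl fun q hq => ?_
    rw [Function.update_of_ne (Finset.ne_of_mem_erase hq)]
  rw [hprod]
  -- Below index `n` the node functionals match; at index `n` the `1`-form shape function vanishes.
  rcases Nat.lt_or_eq_of_le (Nat.lt_succ_iff.1 (J l).2) with hJ | hJ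
  · rw [tensorNode_shift hk hJ]
  · rw [show J l = Fin.last n from Fin.ext hJ, shape_one_last]
    simp

/-- The jets are needed: derivatives and integrals with default values are not additive on arbitrary
functions. -/
theorem IsJet.tensorOp_add {N : ℕ} {D E : (Fin N → ℕ) → (Fin N → ℝ) → ℝ} (hD : IsJet D)
    (hE : IsJet E) {f g : (Fin N → ℝ) → ℝ} (hf : EqOn f (D 0) (cube N))
    (hg : EqOn g (E 0) (cube N)) (m n : ℕ) (k : Fin N → Fin 2) (x : Fin N → ℝ) :
    tensorOp (fun l => interp m n (k l)) (f + g) x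
      = tensorOp (fun l => interp m n (k l)) f x + tensorOp (fun l => interp m n (k l)) g x := by
  rw [(hD.add hE).tensorOp_interp_eq (fun y hy => by simp [hf hy, hg hy]),
    hD.tensorOp_interp_eq hf, hE.tensorOp_interp_eq hg, ← Finset.sum_add_distrib]
  exact Finset.sum_congr rfl fun J _ => by rw [tensorNode_add hD hE, add_mul]

theorem IsJet.tensorOp_smul {N : ℕ} {D : (Fin N → ℕ) → (Fin N → ℝ) → ℝ} (hD : IsJet D)
    {f : (Fin N → ℝ) → ℝ} (hf : EqOn f (D 0) (cube N)) (c : ℝ) (m n : ℕ) (k : Fin N → Fin 2)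
    (x : Fin N → ℝ) :
    tensorOp (fun l => interp m n (k l)) (c • f) x
      = c * tensorOp (fun l => interp m n (k l)) f x := by
  rw [(hD.const_smul c).tensorOp_interp_eq (fun y hy => by simp [hf hy]),
    hD.tensorOp_interp_eq hf, Finset.mul_sum]
  exact Finset.sum_congr rfl fun J _ => by rw [tensorNode_smul, mul_assoc]

theorem IsJet.tensorOp_congr {N : ℕ} {D : (Fin N → ℕ) → (Fin N → ℝ) → ℝ} (hD : IsJet D)
    {f g : (Fin N → ℝ) → ℝ} (hf : EqOn f (D 0) (cube N)) (hg : EqOn g f (cube N)) (m n : ℕ)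
    (k : Fin N → Fin 2) (x : Fin N → ℝ) :
    tensorOp (fun l => interp m n (k l)) g x = tensorOp (fun l => interp m n (k l)) f x := by
  rw [hD.tensorOp_interp_eq hf, hD.tensorOp_interp_eq (hg.trans hf)]

theorem tensorOp_sum {N : ℕ} {ι : Type*} (s : Finset ι) (c : ι → ℝ)
    {D : ι → (Fin N → ℕ) → (Fin N → ℝ) → ℝ} (hD : ∀ i, IsJet (D i)) {f : ι → (Fin N → ℝ) → ℝ}
    (hf : ∀ i, EqOn (f i) (D i 0) (cube N)) (m n : ℕ) (k : Fin N → Fin 2) (x : Fin N → ℝ) :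
    tensorOp (fun l => interp m n (k l)) (∑ i ∈ s, c i • f i) x
      = ∑ i ∈ s, c i * tensorOp (fun l => interp m n (k l)) (f i) x := by
  classical
  induction s using Finset.induction_on with
  | empty => simpa using (isJet_zero N).tensorOp_smul (f := 0) (fun _ _ => rfl) 0 m n k x
  | insert i s hi ih =>
    rw [Finset.sum_insert hi, Finset.sum_insert hi, ← ih, ← (hD i).tensorOp_smul (hf i)]
    refine IsJet.tensorOp_add ((hD i).const_smul (c i))
      (isJet_sum s fun i _ => (hD i).const_smul (c i))
      (fun y hy => by simp [hf i hy]) (fun y hy => ?_) m n k x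
    simp only [Finset.sum_apply, Pi.smul_apply]
    exact Finset.sum_congr rfl fun i _ => by rw [hf i hy]

/-- Products of polynomials are reproduced. -/
theorem tensorOp_prod {m n : ℕ} (hn : 2 * m + 1 ≤ n) {N : ℕ} (k : Fin N → Fin 2)
    {p : Fin N → ℝ[X]} (hp : ∀ l, (p l).natDegree ≤ n - k l) (c : ℝ) (x : Fin N → ℝ) :
    tensorOp (fun l => interp m n (k l)) (fun y => c * ∏ l, (p l).eval (y l)) x
      = c * ∏ l, (p l).eval (x l) := by
  -- The factor in the first variable becomes a scalar for the inner operator, so `c` must vary.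
  induction N generalizing c with
  | zero => simp [tensorOp]
  | succ N ih =>
    have h (t : ℝ) : tensorOp (fun l : Fin N => interp m n (k l.succ))
        (fun y => c * ∏ l, (p l).eval ((Fin.cons t y : Fin (N + 1) → ℝ) l)) (Fin.tail x)
        = (C (c * ∏ l : Fin N, (p l.succ).eval (x l.succ)) * p 0).eval t := by
      simp only [Fin.prod_univ_succ, Fin.cons_zero, Fin.cons_succ, ← mul_assoc]
      rw [ih (fun l => k l.succ) (fun l => hp l.succ)]
      simp only [eval_mul, eval_C, Fin.tail]
      ring
    rw [tensorOp]
    simp only [h]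
    rw [interp_eval hn _ ((natDegree_C_mul_le _ _).trans (hp 0)), Fin.prod_univ_succ]
    simp only [eval_mul, eval_C]
    ring

/-- The normal derivatives of the interpolant on a face of the cube. -/
theorem IsJet.partialDeriv_tensorOp {N : ℕ} {D : (Fin (N + 1) → ℕ) → (Fin (N + 1) → ℝ) → ℝ}
    (hD : IsJet D) {f : (Fin (N + 1) → ℝ) → ℝ} (hf : EqOn f (D 0) (cube (N + 1))) {m n : ℕ}
    (hn : 2 * m + 1 ≤ n) {k : Fin (N + 1) → Fin 2} {l : Fin (N + 1)} {γ : ℕ} (hγ : γ + k l ≤ m)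
    {a : ℝ} (ha : a = 0 ∨ a = 1) (x : Fin (N + 1) → ℝ) :
    partialDeriv l γ (tensorOp (fun q => interp m n (k q)) f) (Function.update x l a)
      = ∑ J, tensorNode m n (l.removeNth k) J (faceJet D l γ a)
        * ∏ q, (shape m n (k (l.succAbove q)) (J q)).eval (x (l.succAbove q)) := by
  set F : ℕ → ℝ → ℝ := fun i t => ∑ J, tensorNode m n k J D *
    (polyJet (shape m n (k l) (J l)) i t *
      ∏ q ∈ Finset.univ.erase l, (shape m n (k q) (J q)).eval (x q)) with hF
  have hFj : IsJetInterval F := fun i t ht => HasDerivWithinAt.fun_sum fun J _ =>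
    ((isJetInterval_polyJet _ i t ht).mul_const _).const_mul _
  have h0 : (fun t => tensorOp (fun q => interp m n (k q)) f (Function.update x l t)) = F 0 := by
    funext t
    rw [hD.tensorOp_interp_eq hf]
    simp only [prod_eval_update]
    rfl
  have ha' : a ∈ Icc (0 : ℝ) 1 := by rcases ha with rfl | rfl <;> simp
  simp only [partialDeriv, Function.update_idem, Function.update_self, h0]
  rw [hFj.iteratedDerivWithin_eq γ ha', hF]
  simp only
  rw [sum_insertNth l]
  refine Finset.sum_congr rfl fun J _ => ?_
  have herase (j : Fin (n + 1)) : ∏ q ∈ Finset.univ.erase l, (shape m n (k q)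
      ((l.insertNth j J : Fin (N + 1) → Fin (n + 1)) q)).eval (x q)
      = ∏ q, (shape m n (k (l.succAbove q)) (J q)).eval (x (l.succAbove q)) := by
    rw [← Finset.compl_singleton, ← Fin.image_succAbove_univ,
      Finset.prod_image (Fin.succAbove_right_injective.injOn)]
    simp
  -- The sum over the index of the normal variable collapses to the end point derivative that
  -- interpolation reproduces.
  rw [← (hD.isJetInterval_tensorNode m n l (l.removeNth k) J).sum_nodeFun_mul_derivative_shape
    hn hγ ha, Finset.sum_mul]
  refine Finset.sum_congr rfl fun j _ => ?_
  rw [herase, hD.tensorNode_eq_nodeFun m n l, Fin.insertNth_apply_same, Fin.removeNth_insertNth,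
    ← mul_assoc]
  rfl

theorem IsJet.partialDeriv_eq {N : ℕ} {D : (Fin N → ℕ) → (Fin N → ℝ) → ℝ} (hD : IsJet D)
    (l : Fin N) (γ : ℕ) : EqOn (partialDeriv l γ (D 0)) (D (Pi.single l γ)) (cube N) := by
  intro x hx
  have hj : IsJetInterval fun i t => D (Pi.single l i) (Function.update x l t) := by
    intro i t ht
    have h := hD.hasDerivWithinAt (Pi.single l i) l _ (update_mem_cube hx l ht)
    simpa only [Function.update_idem, Function.update_self, ← Pi.single_add] using h
  have h := hj.iteratedDerivWithin_eq γ (mem_cube.1 hx l)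
  simp only [Pi.single_zero, Function.update_eq_self] at h
  exact h

/-! ### Coefficients of forms -/

theorem Chi.apply_dirs {N ν : ℕ} (i : Chi N ν) (b : Fin ν) : i.1 (i.dirs b) = 1 := by
  have : i.dirs b ∈ i.support := Finset.orderEmbOfFin_mem ..
  simpa [Chi.support] using this

theorem Chi.exists_dirs_eq {N ν : ℕ} (i : Chi N ν) {l : Fin N} (hl : i.1 l = 1) :
    ∃ b, i.dirs b = l := by
  have : l ∈ Set.range i.dirs := by
    rw [Chi.dirs, Finset.range_orderEmbOfFin]
    simpa [Chi.support] using hl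
  exact this

theorem Chi.dirs_eq_of_strictMono {N ν : ℕ} (i : Chi N ν) {f : Fin ν → Fin N}
    (hf : ∀ b, i.1 (f b) = 1) (hmono : StrictMono f) : i.dirs = f :=
  (Finset.orderEmbOfFin_unique i.card_support (fun b => by simpa [Chi.support] using hf b)
    hmono).symm

/-- The index obtained from `i` by removing the `b`-th direction. -/
def Chi.erase {N ν : ℕ} (i : Chi N (ν + 1)) (b : Fin (ν + 1)) : Chi N ν :=
  ⟨Function.update i.1 (i.dirs b) 0, by
    have h := i.2
    rw [← Finset.add_sum_erase _ _ (Finset.mem_univ (i.dirs b)), i.apply_dirs] at h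
    rw [← Finset.add_sum_erase _ _ (Finset.mem_univ (i.dirs b)), Function.update_self]
    rw [Finset.sum_congr rfl fun l hl => by
      rw [Function.update_of_ne (Finset.ne_of_mem_erase hl)]]
    simp at h ⊢
    omega⟩

theorem Chi.dirs_erase {N ν : ℕ} (i : Chi N (ν + 1)) (b : Fin (ν + 1)) :
    (i.erase b).dirs = i.dirs ∘ b.succAbove := by
  refine Chi.dirs_eq_of_strictMono _ (fun q => ?_)
    (i.dirs.strictMono.comp (Fin.strictMono_succAbove b))
  have : i.dirs (b.succAbove q) ≠ i.dirs b := fun h =>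
    Fin.succAbove_ne b q (i.dirs.injective h)
  exact (Function.update_of_ne this _ _).trans (i.apply_dirs _)

theorem Chi.dx_apply {N ν : ℕ} (i : Chi N ν) (v : Fin ν → Fin N → ℝ) :
    i.dx v = Matrix.det (Matrix.of fun a b => v a (i.dirs b)) := rfl

/-- If the indices differ, some direction of `q` is missing from `i`, and the corresponding row of
the determinant is zero. -/
theorem Chi.dx_single {N ν : ℕ} (i q : Chi N ν) :
    i.dx (fun b => Pi.single (q.dirs b) 1) = if i = q then 1 else 0 := by
  rw [Chi.dx_apply]
  split_ifs with h
  · subst h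
    convert Matrix.det_one (R := ℝ) (n := Fin ν)
    ext a b
    simp [Matrix.one_apply, Pi.single_apply, eq_comm]
  · obtain ⟨b, hb⟩ : ∃ b, i.1 (q.dirs b) ≠ 1 := by
      by_contra! hcon
      have hd := i.dirs_eq_of_strictMono hcon q.dirs.strictMono
      refine h (Subtype.ext (funext fun l => ?_))
      have hl : i.1 l = 1 ↔ q.1 l = 1 := by
        constructor
        · intro hl
          obtain ⟨b, rfl⟩ := i.exists_dirs_eq hl
          rw [hd, q.apply_dirs]
        · intro hl
          obtain ⟨b, rfl⟩ := q.exists_dirs_eq hl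
          exact hcon b
      omega
    refine Matrix.det_eq_zero_of_row_eq_zero b fun a => ?_
    rw [Matrix.of_apply, Pi.single_eq_of_ne]
    intro hab
    exact hb (hab ▸ i.apply_dirs a)

/-- An alternating form is determined by its values on the increasing tuples of unit vectors. -/
theorem alternating_ext {N ν : ℕ} {η₁ η₂ : (Fin N → ℝ) [⋀^Fin ν]→L[ℝ] ℝ}
    (h : ∀ i : Chi N ν, η₁ (fun b => Pi.single (i.dirs b) 1) = η₂ fun b => Pi.single (i.dirs b) 1) :
    η₁ = η₂ := by
  apply ContinuousAlternatingMap.toAlternatingMap_injective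
  refine Module.Basis.ext_alternating (Pi.basisFun ℝ (Fin N)) fun v hinj => ?_
  -- Sorting an injective tuple of unit vectors changes both forms by the same sign, which cancels.
  set σ := Tuple.sort v
  have hmono : StrictMono (v ∘ σ) :=
    (Tuple.monotone_sort v).strictMono_of_injective (hinj.comp σ.injective)
  let i : Chi N ν := ⟨fun l => if l ∈ Set.range v then 1 else 0, by
    have : ∀ l, ((if l ∈ Set.range v then 1 else 0 : Fin 2) : ℕ)
        = if l ∈ Finset.univ.image v then 1 else 0 := fun l => by
      by_cases hl : l ∈ Set.range v <;> simp_all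
    simp only [this]
    rw [Finset.sum_boole, Finset.filter_mem_eq_inter, Finset.univ_inter,
      Finset.card_image_of_injective _ hinj]
    simp⟩
  have hi : i.dirs = v ∘ σ := i.dirs_eq_of_strictMono (fun b => by simp [i]) hmono
  have hw : (fun b => (Pi.single (i.dirs b) 1 : Fin N → ℝ))
      = (fun b => Pi.basisFun ℝ (Fin N) (v b)) ∘ σ := by
    funext b
    simp [hi]
  have hh := h i
  rw [hw] at hh
  have hu := η₁.toAlternatingMap.map_perm (fun b => Pi.basisFun ℝ (Fin N) (v b)) σ
  have hv := η₂.toAlternatingMap.map_perm (fun b => Pi.basisFun ℝ (Fin N) (v b)) σ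
  have hh' : η₁.toAlternatingMap ((fun b => Pi.basisFun ℝ (Fin N) (v b)) ∘ σ)
    = η₂.toAlternatingMap ((fun b => Pi.basisFun ℝ (Fin N) (v b)) ∘ σ) := hh
  rw [hu, hv] at hh'
  exact smul_left_cancel _ hh'

theorem coeff_sum_smul_dx {N ν : ℕ} (c : Chi N ν → (Fin N → ℝ) → ℝ) (i : Chi N ν) :
    Form.coeff (fun x => ∑ q, c q x • q.dx) i = c i := by
  funext x
  simp [Form.coeff, ContinuousAlternatingMap.sum_apply, Chi.dx_single]

theorem coeff_tensorInterp (m n : ℕ) {N ν : ℕ} (u : Form N ν) (i : Chi N ν) :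
    (tensorInterp m n u).coeff i = tensorOp (fun l => interp m n (i.1 l)) (u.coeff i) :=
  coeff_sum_smul_dx (fun i => tensorOp (fun l => interp m n (i.1 l)) (u.coeff i)) i

theorem IsSmooth.coeff {N ν : ℕ} {u : Form N ν} (hu : IsSmooth u) (i : Chi N ν) :
    ContDiffOn ℝ ∞ (u.coeff i) (cube N) :=
  (ContinuousAlternatingMap.apply ℝ (Fin N → ℝ) ℝ
    fun b => Pi.single (i.dirs b) 1).contDiff.comp_contDiffOn hu

theorem IsSmooth.isJet {N ν : ℕ} {u : Form N ν} (hu : IsSmooth u) (i : Chi N ν) :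
    IsJet (smoothJet (u.coeff i)) := isJet_smoothJet (hu.coeff i)

theorem eqOn_smoothJet_zero {N : ℕ} (f : (Fin N → ℝ) → ℝ) (s : Set (Fin N → ℝ)) :
    EqOn f (smoothJet f 0) s := fun x _ => by rw [smoothJet_zero]

theorem isSmooth_dForm {N ν : ℕ} {u : Form N ν} (hu : IsSmooth u) : IsSmooth (dForm u) := by
  have h : ContDiffOn ℝ ∞ (fderivWithin ℝ u (cube N)) (cube N) :=
    ContDiffOn.fderivWithin hu (uniqueDiffOn_cube N) (by simp)
  exact (ContinuousLinearMap.contDiff (𝕜 := ℝ)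
    (E := (Fin N → ℝ) →L[ℝ] (Fin N → ℝ) [⋀^Fin ν]→L[ℝ] ℝ)
    (F := (Fin N → ℝ) [⋀^Fin (ν + 1)]→L[ℝ] ℝ)
    (ContinuousAlternatingMap.alternatizeUncurryFinCLM ℝ (Fin N → ℝ) ℝ)).comp_contDiffOn h

theorem coeff_dForm {N ν : ℕ} {u : Form N ν} (hu : IsSmooth u) (i : Chi N (ν + 1)) :
    EqOn ((dForm u).coeff i)
      (∑ b : Fin (ν + 1), (-1 : ℝ) ^ (b : ℕ) • dirDeriv (i.dirs b) (u.coeff (i.erase b)))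
      (cube N) := by
  intro x hx
  rw [Form.coeff, dForm, extDerivWithin_apply (hu.differentiableOn (by simp) x hx)
    (uniqueDiffOn_cube N x hx), Finset.sum_apply]
  refine Finset.sum_congr rfl fun b _ => ?_
  rw [Pi.smul_apply, smul_eq_mul, zsmul_eq_mul, dirDeriv]
  have : (fun y => u y (b.removeNth fun q => (Pi.single (i.dirs q) 1 : Fin N → ℝ)))
      = u.coeff (i.erase b) := by
    funext y
    rw [Form.coeff, Chi.dirs_erase]
    rfl
  rw [this]
  push_cast
  rfl

theorem isSmooth_tensorInterp (m n : ℕ) {N ν : ℕ} {u : Form N ν} (hu : IsSmooth u) :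
    IsSmooth (tensorInterp m n u) := by
  refine ContDiff.contDiffOn (ContDiff.sum fun i _ => ?_)
  refine ContDiff.fun_smul ?_ contDiff_const
  exact (hu.isJet i).contDiff_tensorOp (eqOn_smoothJet_zero _ _) m n i.1

/-! ### The interpolation operators on forms -/

/-- Both coefficients are the same signed sum over the directions of `i`, and each term is an
instance of `IsJet.hasDerivAt_tensorOp`. -/
theorem tensorInterp_dForm {m n : ℕ} (hn : 2 * m + 1 ≤ n) {N ν : ℕ} {u : Form N ν}
    (hu : IsSmooth u) :
    EqOn (tensorInterp m n (dForm u)) (dForm (tensorInterp m n u)) (cube N) := by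
  intro x hx
  refine alternating_ext fun i => ?_
  change (tensorInterp m n (dForm u)).coeff i x = (dForm (tensorInterp m n u)).coeff i x
  have hI := isSmooth_tensorInterp m n hu
  have hsum : EqOn ((dForm u).coeff i) (∑ b : Fin (ν + 1), (-1 : ℝ) ^ (b : ℕ) •
      smoothJet (u.coeff (i.erase b)) (Pi.single (i.dirs b) 1)) (cube N) := by
    intro y hy
    rw [coeff_dForm hu i hy, Finset.sum_apply, Finset.sum_apply]
    refine Finset.sum_congr rfl fun b _ => ?_
    rw [Pi.smul_apply, Pi.smul_apply, dirDeriv_eq_smoothJet (hu.coeff _) _ hy]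
  rw [coeff_tensorInterp, coeff_dForm hI i hx,
    ← ((isSmooth_dForm hu).isJet i).tensorOp_congr (eqOn_smoothJet_zero _ _) hsum.symm,
    tensorOp_sum _ _ (fun b => ((hu.isJet (i.erase b)).shift (Pi.single (i.dirs b) 1)))
      (fun b y _ => by rw [zero_add]), Finset.sum_apply]
  refine Finset.sum_congr rfl fun b _ => ?_
  rw [Pi.smul_apply, smul_eq_mul]
  congr 1
  refine (dirDeriv_eq hx ((hI.coeff _).differentiableOn (by simp) x hx) ?_).symm
  rw [coeff_tensorInterp]
  exact ((hu.isJet (i.erase b)).hasDerivAt_tensorOp (eqOn_smoothJet_zero _ _) (fun _ _ => rfl) hn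
    (i.apply_dirs b) x).hasDerivWithinAt

theorem tensorInterp_mem_tensorSpace {m n : ℕ} (hn : 2 * m + 1 ≤ n) {N ν : ℕ} {u : Form N ν}
    (hu : IsSmooth u) : tensorInterp m n u ∈ tensorSpace n N ν := by
  have h : tensorInterp m n u = ∑ i : Chi N ν, ∑ J, tensorNode m n i.1 J (smoothJet (u.coeff i)) •
      rankOne i fun l => shape m n (i.1 l) (J l) := by
    funext x
    simp only [Finset.sum_apply, Pi.smul_apply, rankOne, tensorInterp]
    refine Finset.sum_congr rfl fun i _ => ?_
    rw [(hu.isJet i).tensorOp_interp_eq (eqOn_smoothJet_zero _ _), Finset.sum_smul]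
    simp only [mul_smul]
  rw [h]
  refine Submodule.sum_mem _ fun i _ => Submodule.sum_mem _ fun J _ => Submodule.smul_mem _ _
    (Submodule.subset_span ⟨i, _, fun l => ?_, rfl⟩)
  rw [mem_degreeLE]
  exact natDegree_le_iff_degree_le.1 (natDegree_shape_le hn _ _)

theorem isSmooth_rankOne {N ν : ℕ} (i : Chi N ν) (p : Fin N → ℝ[X]) : IsSmooth (rankOne i p) := by
  refine ContDiff.contDiffOn (ContDiff.fun_smul (contDiff_prod fun l _ => ?_) contDiff_const)
  exact (p l).contDiff_aeval ∞ |>.comp (contDiff_apply ℝ ℝ l)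

theorem coeff_rankOne {N ν : ℕ} (i q : Chi N ν) (p : Fin N → ℝ[X]) :
    (rankOne i p).coeff q = fun x => (if i = q then 1 else 0) * ∏ l, (p l).eval (x l) := by
  funext x
  simp [Form.coeff, rankOne, Chi.dx_single]

theorem tensorInterp_rankOne {m n : ℕ} (hn : 2 * m + 1 ≤ n) {N ν : ℕ} (i : Chi N ν)
    {p : Fin N → ℝ[X]} (hp : ∀ l, (p l).natDegree ≤ n - i.1 l) :
    tensorInterp m n (rankOne i p) = rankOne i p := by
  funext x
  rw [tensorInterp, Finset.sum_eq_single_of_mem i (Finset.mem_univ i)]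
  · rw [coeff_rankOne, tensorOp_prod hn _ hp, if_pos rfl, one_mul, rankOne]
  · intro q _ hq
    have h := tensorOp_prod hn q.1 (p := 0) (by simp) 0 x
    rw [coeff_rankOne, if_neg hq.symm]
    simp only [zero_mul] at h ⊢
    rw [h, zero_smul]

/-- Smoothness is carried along in the induction because additivity of interpolation requires it. -/
theorem isSmooth_and_tensorInterp_eq {m n : ℕ} (hn : 2 * m + 1 ≤ n) {N ν : ℕ} {w : Form N ν}
    (hw : w ∈ tensorSpace n N ν) : IsSmooth w ∧ tensorInterp m n w = w := by
  induction hw using Submodule.span_induction with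
  | mem w hw =>
    obtain ⟨i, p, hp, rfl⟩ := hw
    refine ⟨isSmooth_rankOne i p, tensorInterp_rankOne hn i fun l => ?_⟩
    exact natDegree_le_iff_degree_le.2 (mem_degreeLE.1 (hp l))
  | zero =>
    refine ⟨contDiffOn_const, funext fun x => Finset.sum_eq_zero fun i _ => ?_⟩
    have h := (isJet_zero N).tensorOp_smul (f := 0) (fun _ _ => rfl) 0 m n i.1 x
    rw [zero_smul, zero_mul] at h
    rw [show (0 : Form N ν).coeff i = 0 from rfl, h, zero_smul]
  | add w v _ _ hw hv =>
    refine ⟨hw.1.add hv.1, funext fun x => ?_⟩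
    rw [Pi.add_apply, ← congrFun hw.2 x, ← congrFun hv.2 x]
    simp only [tensorInterp, ← Finset.sum_add_distrib, ← add_smul]
    refine Finset.sum_congr rfl fun i _ => ?_
    rw [← (hw.1.isJet i).tensorOp_add (hv.1.isJet i) (eqOn_smoothJet_zero _ _)
      (eqOn_smoothJet_zero _ _)]
    rfl
  | smul c w _ hw =>
    refine ⟨hw.1.const_smul c, funext fun x => ?_⟩
    rw [Pi.smul_apply, ← congrFun hw.2 x]
    simp only [tensorInterp, Finset.smul_sum, ← mul_smul]
    refine Finset.sum_congr rfl fun i _ => ?_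
    rw [← (hw.1.isJet i).tensorOp_smul (eqOn_smoothJet_zero _ _)]
    rfl

theorem sameTraces_tensorInterp {m n : ℕ} (hn : 2 * m + 1 ≤ n) {N ν : ℕ} {u v : Form N ν}
    (hu : IsSmooth u) (hv : IsSmooth v) {l : Fin N} {a b : ℝ} (ha : a = 0 ∨ a = 1)
    (hb : b = 0 ∨ b = 1) (h : SameTraces m l a b u v) :
    SameTraces m l a b (tensorInterp m n u) (tensorInterp m n v) := by
  obtain _ | N := N
  · exact l.elim0
  intro i γ hγ x _
  have ha' : a ∈ Icc (0 : ℝ) 1 := by rcases ha with rfl | rfl <;> simp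
  have hb' : b ∈ Icc (0 : ℝ) 1 := by rcases hb with rfl | rfl <;> simp
  have htrace {w : Form (N + 1) ν} (hw : IsSmooth w) {c : ℝ} (hc : c ∈ Icc (0 : ℝ) 1)
      {y : Fin N → ℝ} (hy : y ∈ cube N) : faceJet (smoothJet (w.coeff i)) l γ c 0 y
        = partialDeriv l γ (w.coeff i) (Function.update (l.insertNth 0 y) l c) := by
    have := (hw.isJet i).partialDeriv_eq l γ (insertNth_mem_cube (l := l) hc hy)
    rw [smoothJet_zero] at this
    rw [Fin.update_insertNth, this, faceJet, Fin.insertNth_zero_right]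
  -- The hypothesis equates the first members of the two face jets; all tangential derivatives then
  -- agree.
  have hface := fun α => ((hu.isJet i).face l γ ha').eqOn ((hv.isJet i).face l γ hb')
    (fun y hy => by
      rw [htrace hu ha' hy, htrace hv hb' hy]
      exact h i γ hγ _ (insertNth_mem_cube (by simp) hy)) α
  rw [coeff_tensorInterp, coeff_tensorInterp,
    (hu.isJet i).partialDeriv_tensorOp (eqOn_smoothJet_zero _ _) hn hγ ha,
    (hv.isJet i).partialDeriv_tensorOp (eqOn_smoothJet_zero _ _) hn hγ hb]
  exact Finset.sum_congr rfl fun J _ => by rw [tensorNode_congr hface]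

end TPFE

end

theorem lemma2 (N m n : ℕ) (hn : 2 * m + 1 ≤ n) (ν : ℕ) :
    -- the interpolation operators are cochain maps
    (∀ u : TPFE.Form N ν, TPFE.IsSmooth u →
      Set.EqOn (TPFE.tensorInterp m n (TPFE.dForm u)) (TPFE.dForm (TPFE.tensorInterp m n u))
        (TPFE.cube N)) ∧
    -- the tensor product spaces form a subcomplex of the smooth de Rham complex
    (∀ w ∈ TPFE.tensorSpace n N ν, TPFE.IsSmooth w ∧
      ∃ w' ∈ TPFE.tensorSpace n N (ν + 1), Set.EqOn (TPFE.dForm w) w' (TPFE.cube N)) ∧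
    -- interpolation is a projection onto the tensor product space
    (∀ u : TPFE.Form N ν, TPFE.IsSmooth u →
      TPFE.tensorInterp m n u ∈ TPFE.tensorSpace n N ν) ∧
    (∀ w ∈ TPFE.tensorSpace n N ν, Set.EqOn (TPFE.tensorInterp m n w) w (TPFE.cube N)) ∧
    -- conformity: matching traces of order `m` across a face are preserved by interpolation
    (∀ u v : TPFE.Form N ν, TPFE.IsSmooth u → TPFE.IsSmooth v →
      ∀ (l : Fin N) (a b : ℝ), (a = 0 ∨ a = 1) → (b = 0 ∨ b = 1) →
        TPFE.SameTraces m l a b u v →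
        TPFE.SameTraces m l a b (TPFE.tensorInterp m n u) (TPFE.tensorInterp m n v)) := by
  refine ⟨fun u hu => TPFE.tensorInterp_dForm hn hu, fun w hw => ?_,
    fun u hu => TPFE.tensorInterp_mem_tensorSpace hn hu,
    fun w hw x _ => congrFun (TPFE.isSmooth_and_tensorInterp_eq hn hw).2 x,
    fun u v hu hv l a b ha hb h => TPFE.sameTraces_tensorInterp hn hu hv ha hb h⟩
  obtain ⟨hs, hI⟩ := TPFE.isSmooth_and_tensorInterp_eq (m := m) hn hw
  -- The witness is the interpolant of `dw`, which equals `d` of the interpolant of `w`, that is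
  -- `dw`.
  refine ⟨hs, _, TPFE.tensorInterp_mem_tensorSpace hn (TPFE.isSmooth_dForm hs), fun x hx => ?_⟩
  rw [TPFE.tensorInterp_dForm hn hs hx, hI]
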